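/- Let $P$ be an infinite set of positive integers (for instance all primes), and fix $\mu>0$ and $0<\varepsilon<1$. For each $p\in P$ let $\mathcal H_p$ be a complex Hilbert space of dimension $p$, let $\mathfrak X_p$ be a finite set, and for every $x\in\mathfrak X_p$ let $B_x=\{b_x^1,\dots,b_x^p\}$ be an orthonormal basis of $\mathcal H_p$. Assume that $|\mathfrak X_p|\to\infty$ as $p\to\infty$ and that the bases are pairwise $\mu$-coherent: $|\langle b_x^i,b_y^j\rangle|\le \mu/\sqrt p$ for all $x\ne y$ in $\mathfrak X_p$ and all $i,j$. Let $\mathfrak D_p=\bigsqcup_{x\in\mathfrak X_p}B_x$, and let $n=n(p)$ be natural numbers with $n(p)/p^{1-\varepsilon}\to1$ (for instance $n=\lfloor p^{1-\varepsilon}\rfloor$). Let $\Omega_n$ be the set of injective maps $S:\{1,\dots,n\}\to\mathfrak D_p$ with the uniform probability measure. For $S\in\Omega_n$ let $\mathbf G(S)$ be the $n\times n$ Gram matrix of the vectors $S(1),\dots,S(n)$, put $\mathbf E(S)=(p/n)^{1/2}(\mathbf G(S)-I_n)$, and let $\rho_{\mathbf E(S)}=\frac1n\sum_{i=1}^n\delta_{\lambda_i}$,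 where $\lambda_1,\dots,\lambda_n$ are the eigenvalues of the Hermitian matrix $\mathbf E(S)$ counted with multiplicity. Then, as $p\to\infty$ in $P$, $\rho_{\mathbf E}$ converges weakly in probability to the Wigner semicircle distribution $\rho_{SC}$, the measure with density $\frac1{2\pi}\sqrt{4-x^2}\,\mathbf 1_{[-2,2]}(x)$; that is, for every bounded continuous $f:\mathbb R\to\mathbb R$ and every $\delta>0$, $$\lim_{p\to\infty}\Pr\Bigl(\Bigl|\int f\,d\rho_{\mathbf E}-\int f\,d\rho_{SC}\Bigr|\ge\delta\Bigr)=0.$$ -/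

import Mathlib

open Filter Topology MeasureTheory
open scoped BoundedContinuousFunction Asymptotics

universe u v

/-- A family `B` of orthonormal bases of a `p`-dimensional complex Hilbert space is pairwise
`μ`-coherent if `|⟨b, b'⟩| ≤ μ / √p` for atoms `b`, `b'` of two different bases of the family. -/
def PairwiseCoherent {X : Type v} {p : ℕ} {H : Type u} [NormedAddCommGroup H]
    [InnerProductSpace ℂ H] (μ : ℝ) (B : X → OrthonormalBasis (Fin p) ℂ H) : Prop :=
  ∀ x y : X, x ≠ y → ∀ i j : Fin p, ‖inner ℂ (B x i) (B y j)‖ ≤ μ / √(p : ℝ)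

/-- The (indices of the) atoms of the dictionary: the disjoint union over `x : X` of orthonormal
bases with `p` elements each. -/
abbrev Atom (X : Type v) (p : ℕ) : Type v := X × Fin p

/-- The sample space: injective maps from an `n`-element set to the dictionary. -/
def Sample (X : Type v) (p n : ℕ) : Type v := Fin n ↪ Atom X p

/-- Every set of samples is an event. -/
instance (X : Type v) (p n : ℕ) : MeasurableSpace (Sample X p n) := ⊤

/-- The uniform probability measure on the sample space. -/
noncomputable def uniformSample (X : Type v) (p n : ℕ) : Measure (Sample X p n) :=
  ProbabilityTheory.uniformOn Set.univ

section Gram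

variable {X : Type v} {p n : ℕ} {H : Type u} [NormedAddCommGroup H] [InnerProductSpace ℂ H]

/-- The Gram matrix `Θ_S^* Θ_S` of the vectors selected by the sample `S`. -/
noncomputable def sampleGram (B : X → OrthonormalBasis (Fin p) ℂ H) (S : Sample X p n) :
    Matrix (Fin n) (Fin n) ℂ :=
  Matrix.gram ℂ (fun i : Fin n => B (S.toFun i).1 (S.toFun i).2)

/-- The normalized error term `(p / n) ^ (1 / 2) (G - I)`. -/
noncomputable def errorTerm (B : X → OrthonormalBasis (Fin p) ℂ H) (S : Sample X p n) :
    Matrix (Fin n) (Fin n) ℂ :=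
  √((p : ℝ) / (n : ℝ)) • (sampleGram B S - 1)

theorem errorTerm_isHermitian (B : X → OrthonormalBasis (Fin p) ℂ H) (S : Sample X p n) :
    (errorTerm B S).IsHermitian := by
  have h : (sampleGram B S - 1).IsHermitian :=
    (Matrix.isHermitian_gram ℂ _).sub Matrix.isHermitian_one
  unfold errorTerm
  rw [Matrix.IsHermitian, Matrix.conjTranspose_smul, h.eq]
  simp

/-- The spectral distribution `(1 / n) ∑ δ_{λ_i}` of the error term, where the `λ_i` are its
eigenvalues, counted with multiplicity. -/
noncomputable def errorSpectralDistribution (B : X → OrthonormalBasis (Fin p) ℂ H)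
    (S : Sample X p n) : Measure ℝ :=
  (n : ENNReal)⁻¹ • ∑ i : Fin n, Measure.dirac ((errorTerm_isHermitian B S).eigenvalues i)

end Gram

/-- The Wigner semicircle distribution, with density `(1 / 2π) √(4 - x²)` on `[-2, 2]`. -/
noncomputable def semicircleDistribution : Measure ℝ :=
  volume.withDensity fun x : ℝ => ENNReal.ofReal
    ((Set.Icc (-2 : ℝ) 2).indicator (fun y : ℝ => 1 / (2 * Real.pi) * √(4 - y ^ 2)) x)

/-- Convergence in probability, with respect to the weak topology, of random measures `ρ i` on `ℝ`
to a deterministic measure `ν`; the `ρ i` may live on different probability spaces. -/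
def TendstoInProbabilityWeakly {ι : Type*} {Ω : ι → Type*} [∀ i, MeasurableSpace (Ω i)]
    (P : ∀ i, Measure (Ω i)) (ρ : ∀ i, Ω i → Measure ℝ) (l : Filter ι) (ν : Measure ℝ) : Prop :=
  ∀ f : ℝ →ᵇ ℝ, ∀ δ : ℝ, 0 < δ →
    Tendsto (fun i => P i {ω | δ ≤ |∫ x, f x ∂(ρ i ω) - ∫ x, f x ∂ν|}) l (𝓝 0)

/-! The proof is the method of moments. The `k`-th moment of the spectral distribution is a
normalized trace, hence a sum of products of Gram entries over loopless closed walks of length `k`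
in the index set. The mean of a product of two moments is a sum over pairs of such walks
(`embAvg_kernelMoment_mul`).

Two properties of the dictionary are used. Off-diagonal Gram entries are `O(p^(-1/2))`, and, by
Parseval in each basis, the Gram kernel reproduces itself up to the number `x` of bases. By the
second property a vertex `v` passed exactly once, between `a` and `c`, can be averaged out
(`embAvg_edgeProd_resample`), at the price of terms in which `v` is identified with another vertex.
In the normalization `n^|U| (p/n)^(|E|/2)`, pruning a leaf (`a = c`) preserves the value to leading
order, a shortcut (`a ≠ c`) costs `√(n/p)`, and an identification costs `1/x`
(`norm_scaledAvg_sub_le`). If no vertex can be removed, there are more than twice as many edges as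
free vertices (`RootedFlow.two_mul_card_lt`), and coherence alone gains `n^(-1/2)`.

Hence only walks that shrink to a point by pruning leaves survive. They are the depth-first
traversals of trees, and each contributes `1` (`norm_pairAvg_sub_le`). Their weighted number tends
to a count of Dyck paths (`abs_treeCount_sub_le`), which is the corresponding semicircle moment
(`integral_pow_semicircleDistribution`). Pairs of walks that meet lose a factor `n`, so the mean of
a product factorizes in the limit and the moments concentrate (`uniformSample_moment_le`). Finally
`exists_moment_bound` passes from finitely many moments to a bounded continuous test function. -/

set_option linter.unusedSectionVars false

/-! ### Averages over random injections and resampling of one vertex. -/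

section Averages

variable {I : Type*} {D : Type*} [Fintype I] [DecidableEq I] [Fintype D] [DecidableEq D]

/-- The average of a function over all injective maps `I ↪ D`. -/
noncomputable def embAvg (φ : (I ↪ D) → ℂ) : ℂ :=
  (Fintype.card (I ↪ D) : ℂ)⁻¹ * ∑ S, φ S

/-- The injective map with one value replaced by a value that the other points do not take. -/
def embUpdate (S : I ↪ D) (v : I) (b : D) (h : ∀ w, w ≠ v → S w ≠ b) : I ↪ D :=
  ⟨Function.update S v b, by
    intro y z hyz
    by_cases hy : y = v <;> by_cases hz : z = v
    · rw [hy, hz]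
    · subst hy
      rw [Function.update_self, Function.update_of_ne hz] at hyz
      exact absurd hyz.symm (h z hz)
    · subst hz
      rw [Function.update_self, Function.update_of_ne hy] at hyz
      exact absurd hyz (h y hy)
    · rw [Function.update_of_ne hz, Function.update_of_ne hy] at hyz
      exact S.injective hyz⟩

lemma embUpdate_self (S : I ↪ D) (v : I) (b : D) (h : ∀ w, w ≠ v → S w ≠ b) :
    embUpdate S v b h v = b :=
  Function.update_self ..

lemma embUpdate_of_ne (S : I ↪ D) {v : I} (b : D) (h : ∀ w, w ≠ v → S w ≠ b) {w : I}
    (hw : w ≠ v) : embUpdate S v b h w = S w :=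
  Function.update_of_ne hw ..

/-- Exchanging `b` with `S v` is an involution on the pairs `(S, b)` for which `b` is not a value of
`S` off `v`. Since `ψ` ignores the value at `v`, the involution turns `ψ S b` into `ψ S (S v)`. Each
`S` admits `|D| - |I| + 1` such `b`. -/
lemma sum_resample_aux (v : I) (ψ : (I ↪ D) → D → ℂ)
    (hψ : ∀ S S' : I ↪ D, (∀ w, w ≠ v → S w = S' w) → ψ S = ψ S') :
    ∑ S : I ↪ D, ∑ b ∈ Finset.univ.filter (fun b => ∀ w, w ≠ v → S w ≠ b), ψ S b =
      ((Fintype.card D : ℂ) - Fintype.card I + 1) * ∑ S : I ↪ D, ψ S (S v) := by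
  have hcard : ∀ S : I ↪ D,
      ((Finset.univ.filter (fun b => ∀ w, w ≠ v → S w ≠ b)).card : ℂ) =
        (Fintype.card D : ℂ) - Fintype.card I + 1 := by
    intro S
    have h1 : Finset.univ.filter (fun b => ∀ w, w ≠ v → S w ≠ b) =
        ((Finset.univ.erase v).map S)ᶜ := by
      ext b
      simp only [Finset.mem_filter, Finset.mem_univ, true_and, and_true, Finset.mem_compl,
        Finset.mem_map, Finset.mem_erase, not_exists, not_and]
    have hI : 1 ≤ Fintype.card I := Fintype.card_pos_iff.mpr ⟨v⟩
    have hle : Fintype.card I ≤ Fintype.card D := Fintype.card_le_of_embedding S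
    rw [h1, Finset.card_compl, Finset.card_map, Finset.card_erase_of_mem (Finset.mem_univ v),
      Finset.card_univ, Nat.cast_sub (by omega), Nat.cast_sub hI]
    push_cast
    ring
  have h2 : ∑ S : I ↪ D, ∑ b ∈ Finset.univ.filter (fun b => ∀ w, w ≠ v → S w ≠ b), ψ S b =
      ∑ S : I ↪ D, ∑ _b ∈ Finset.univ.filter (fun b => ∀ w, w ≠ v → S w ≠ b), ψ S (S v) := by
    rw [Finset.sum_sigma', Finset.sum_sigma']
    have hm : ∀ s ∈ (Finset.univ : Finset (I ↪ D)).sigma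
        (fun S => Finset.univ.filter (fun b => ∀ w, w ≠ v → S w ≠ b)),
        ∀ w, w ≠ v → s.1 w ≠ s.2 := by
      intro s hs
      simpa using hs
    refine Finset.sum_bij' (fun s hs => ⟨embUpdate s.1 v s.2 (hm s hs), s.1 v⟩)
      (fun s hs => ⟨embUpdate s.1 v s.2 (hm s hs), s.1 v⟩) ?_ ?_ ?_ ?_ ?_
    · intro s hs
      simp only [Finset.mem_sigma, Finset.mem_univ, Finset.mem_filter, true_and]
      intro w hw
      rw [embUpdate_of_ne _ _ _ hw]
      exact fun h => hw (s.1.injective h)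
    · intro s hs
      simp only [Finset.mem_sigma, Finset.mem_univ, Finset.mem_filter, true_and]
      intro w hw
      rw [embUpdate_of_ne _ _ _ hw]
      exact fun h => hw (s.1.injective h)
    · rintro ⟨S, b⟩ hs
      refine Sigma.ext ?_ (heq_of_eq (embUpdate_self S v b (hm _ hs)))
      ext w
      by_cases hw : w = v
      · rw [hw, embUpdate_self]
      · rw [embUpdate_of_ne _ _ _ hw, embUpdate_of_ne _ _ _ hw]
    · rintro ⟨S, b⟩ hs
      refine Sigma.ext ?_ (heq_of_eq (embUpdate_self S v b (hm _ hs)))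
      ext w
      by_cases hw : w = v
      · rw [hw, embUpdate_self]
      · rw [embUpdate_of_ne _ _ _ hw, embUpdate_of_ne _ _ _ hw]
    · rintro ⟨S, b⟩ hs
      rw [embUpdate_self, hψ _ S fun w hw => embUpdate_of_ne _ _ _ hw]
  rw [h2, Finset.mul_sum]
  refine Finset.sum_congr rfl fun S _ => ?_
  rw [Finset.sum_const, nsmul_eq_mul, hcard]

lemma sum_comp_perm (σ : Equiv.Perm I) (φ : (I ↪ D) → ℂ) :
    ∑ S : I ↪ D, φ (σ.toEmbedding.trans S) = ∑ S, φ S :=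
  Fintype.sum_equiv (Equiv.embeddingCongr σ.symm (Equiv.refl D)) _ _ (fun S => by
    congr 1)

/-- Replacing the value at `v` of a random injective map by a value that is uniform on `D`. -/
lemma sum_resample (V : Finset I) {v : I} (hv : v ∈ V) (ψ : (I ↪ D) → D → ℂ)
    (hψ : ∀ S S' : I ↪ D, (∀ w ∈ V, w ≠ v → S w = S' w) → ψ S = ψ S') :
    ∑ S : I ↪ D, ∑ b, ψ S b =
      ((Fintype.card D : ℂ) - V.card + 1) * ∑ S : I ↪ D, ψ S (S v) +
        ∑ w ∈ V.erase v, ∑ S : I ↪ D, ψ S (S w) := by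
  have h1 : ∀ S : I ↪ D, ∑ b, ψ S b =
      ∑ b ∈ Finset.univ.filter (fun b => ∀ w, w ≠ v → S w ≠ b), ψ S b +
        ∑ w ∈ Finset.univ.erase v, ψ S (S w) := by
    intro S
    rw [← Finset.sum_filter_add_sum_filter_not Finset.univ (fun b => ∀ w, w ≠ v → S w ≠ b)]
    congr 1
    have : Finset.univ.filter (fun b => ¬ ∀ w, w ≠ v → S w ≠ b) =
        (Finset.univ.erase v).map S := by
      ext b
      simp only [Finset.mem_filter, Finset.mem_univ, true_and, and_true, Finset.mem_map,
        Finset.mem_erase, not_forall, exists_prop, not_not]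
    rw [this, Finset.sum_map]
  have h2 : ∑ S : I ↪ D, ∑ b, ψ S b =
      ((Fintype.card D : ℂ) - Fintype.card I + 1) * ∑ S : I ↪ D, ψ S (S v) +
        ∑ w ∈ Finset.univ.erase v, ∑ S : I ↪ D, ψ S (S w) := by
    rw [← sum_resample_aux v ψ (fun S S' h => hψ S S' fun w _ hw => h w hw), Finset.sum_comm
      (s := Finset.univ.erase v), ← Finset.sum_add_distrib]
    exact Finset.sum_congr rfl fun S _ => h1 S
  -- An index outside `V` is exchangeable with `v`, so its collision term joins the main one. Only
  -- `|V| - 1` corrections remain, a number that does not grow with `|I|`.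
  have h3 : ∀ w ∈ Vᶜ, ∑ S : I ↪ D, ψ S (S w) = ∑ S : I ↪ D, ψ S (S v) := by
    intro w hw
    rw [Finset.mem_compl] at hw
    rw [← sum_comp_perm (Equiv.swap v w) (fun S => ψ S (S w))]
    refine Finset.sum_congr rfl fun S _ => ?_
    have : ψ ((Equiv.swap v w).toEmbedding.trans S) = ψ S := by
      refine hψ _ _ fun z hz hzv => ?_
      have : z ≠ w := fun h => hw (h ▸ hz)
      simp [Equiv.swap_apply_of_ne_of_ne hzv this]
    rw [this]
    simp
  have h4 : Finset.univ.erase v = V.erase v ∪ Vᶜ := by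
    ext w
    by_cases hw : w ∈ V <;> simp [hw]
    rintro rfl
    exact hw hv
  have h5 : Disjoint (V.erase v) Vᶜ :=
    Finset.disjoint_of_subset_left (Finset.erase_subset _ _) disjoint_compl_right
  rw [h2, h4, Finset.sum_union h5, Finset.sum_congr rfl h3, Finset.sum_const, nsmul_eq_mul,
    Finset.card_compl, Nat.cast_sub (Finset.card_le_univ V)]
  ring

/-- The product of a kernel over the edges of a directed multigraph. -/
def edgeProd (g : D → D → ℂ) (es : Multiset (I × I)) (S : I ↪ D) : ℂ :=
  (es.map fun e => g (S e.1) (S e.2)).prod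

lemma edgeProd_cons (g : D → D → ℂ) (e : I × I) (es : Multiset (I × I)) (S : I ↪ D) :
    edgeProd g (e ::ₘ es) S = g (S e.1) (S e.2) * edgeProd g es S := by
  simp [edgeProd]

lemma edgeProd_congr (g : D → D → ℂ) (es : Multiset (I × I)) (S S' : I ↪ D)
    (h : ∀ e ∈ es, S e.1 = S' e.1 ∧ S e.2 = S' e.2) : edgeProd g es S = edgeProd g es S' := by
  unfold edgeProd
  congr 1
  refine Multiset.map_congr rfl fun e he => ?_
  rw [(h e he).1, (h e he).2]

/-- A reproducing kernel with unit diagonal and small off-diagonal entries: the Gram kernel of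
a `μ`-coherent union of `x` orthonormal bases in dimension `p`. -/
structure IsCoherentKernel (g : D → D → ℂ) (μ p x : ℝ) : Prop where
  diag : ∀ a, g a a = 1
  coherent : ∀ a b, a ≠ b → ‖g a b‖ ≤ μ / √p
  reproducing : ∀ a c, ∑ b, g a b * g b c = x * g a c
  card : (Fintype.card D : ℝ) = x * p

lemma edgeProd_loop {g : D → D → ℂ} (hg : ∀ a, g a a = 1) (a : I) (es : Multiset (I × I)) :
    edgeProd g ((a, a) ::ₘ es) = edgeProd g es := by
  ext S
  rw [edgeProd_cons, hg, one_mul]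

/-- Averaging out a vertex `v` with a single incoming edge `(a, v)` and a single outgoing edge
`(v, c)`. -/
lemma embAvg_edgeProd_resample {g : D → D → ℂ} {μ p x : ℝ} (hg : IsCoherentKernel g μ p x)
    (V : Finset I) {a v c : I} (hv : v ∈ V) (ha : a ∈ V) (hc : c ∈ V) (hav : a ≠ v)
    (hcv : c ≠ v) (es : Multiset (I × I))
    (hes : ∀ e ∈ es, (e.1 ∈ V ∧ e.1 ≠ v) ∧ (e.2 ∈ V ∧ e.2 ≠ v)) :
    (x : ℂ) * embAvg (edgeProd g ((a, c) ::ₘ es)) =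
      ((x : ℂ) * p - V.card + 1) * embAvg (edgeProd g ((a, v) ::ₘ (v, c) ::ₘ es)) +
        ∑ w ∈ V.erase v, embAvg (edgeProd g ((a, w) ::ₘ (w, c) ::ₘ es)) := by
  have h := sum_resample V hv (fun (S : I ↪ D) b => g (S a) b * (g b (S c) * edgeProd g es S)) (by
    intro S S' h
    ext b
    rw [h a ha hav, h c hc hcv, edgeProd_congr g es S S']
    exact fun e he => ⟨h _ (hes e he).1.1 (hes e he).1.2, h _ (hes e he).2.1 (hes e he).2.2⟩)
  have hN : (Fintype.card D : ℂ) = x * p := by exact_mod_cast congrArg (fun r : ℝ => (r : ℂ)) hg.card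
  have h1 : ∀ S : I ↪ D, ∑ b, g (S a) b * (g b (S c) * edgeProd g es S) =
      x * edgeProd g ((a, c) ::ₘ es) S := by
    intro S
    rw [edgeProd_cons, ← mul_assoc, ← hg.reproducing, Finset.sum_mul]
    simp only [mul_assoc]
  simp only [h1, hN, ← Finset.mul_sum] at h
  have h2 : ∀ w, embAvg (edgeProd g ((a, w) ::ₘ (w, c) ::ₘ es)) =
      (Fintype.card (I ↪ D) : ℂ)⁻¹ *
        ∑ S : I ↪ D, g (S a) (S w) * (g (S w) (S c) * edgeProd g es S) := by
    intro w
    simp [embAvg, edgeProd_cons]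
  simp only [h2, ← Finset.mul_sum]
  unfold embAvg
  linear_combination (Fintype.card (I ↪ D) : ℂ)⁻¹ * h

lemma norm_embAvg_le (φ : (I ↪ D) → ℂ) {C : ℝ} (hC : 0 ≤ C) (h : ∀ S, ‖φ S‖ ≤ C) :
    ‖embAvg φ‖ ≤ C := by
  unfold embAvg
  rw [norm_mul, norm_inv, Complex.norm_natCast]
  rcases Nat.eq_zero_or_pos (Fintype.card (I ↪ D)) with h0 | h0
  · simp [h0, hC]
  · have : ‖∑ S, φ S‖ ≤ Fintype.card (I ↪ D) * C := by
      refine (norm_sum_le _ _).trans ?_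
      refine (Finset.sum_le_sum fun S _ => h S).trans ?_
      simp
    rw [inv_mul_le_iff₀ (by exact_mod_cast h0)]
    exact this

lemma norm_edgeProd_le {g : D → D → ℂ} {μ p x : ℝ} (hg : IsCoherentKernel g μ p x)
    (es : Multiset (I × I)) (hes : ∀ e ∈ es, e.1 ≠ e.2) (S : I ↪ D) :
    ‖edgeProd g es S‖ ≤ (μ / √p) ^ es.card := by
  induction es using Multiset.induction with
  | empty => simp [edgeProd]
  | cons e es ih =>
    rw [edgeProd_cons, norm_mul, Multiset.card_cons, pow_succ']
    have h1 := hg.coherent (S e.1) (S e.2)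
      (fun h => hes e (Multiset.mem_cons_self _ _) (S.injective h))
    exact mul_le_mul h1 (ih fun e' h' => hes e' (Multiset.mem_cons_of_mem h'))
      (norm_nonneg _) ((norm_nonneg _).trans h1)

end Averages

/-! ### Balanced rooted multigraphs, elimination of vertices, and bounds for scaled averages. -/

section Flows

variable {I : Type*} {D : Type*} [Fintype I] [DecidableEq I] [Fintype D] [DecidableEq D]

/-- A balanced loopless directed multigraph with vertices `R ∪ U`, every vertex of which is
reachable from the set `R` of roots. -/
structure RootedFlow (R U : Finset I) (es : Multiset (I × I)) : Prop where
  disj : Disjoint R U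
  loopless : ∀ e ∈ es, e.1 ≠ e.2
  mem : ∀ e ∈ es, e.1 ∈ R ∪ U ∧ e.2 ∈ R ∪ U
  balanced : es.map Prod.fst = es.map Prod.snd
  cut : ∀ W ⊆ U, W.Nonempty → ∃ e ∈ es, e.1 ∉ W ∧ e.2 ∈ W

namespace RootedFlow

variable {R U : Finset I} {es : Multiset (I × I)}

/-- Balance turns in-degree one into out-degree one, and looplessness makes the incoming and the
outgoing edge distinct. -/
lemma exists_split (h : RootedFlow R U es) {v : I} (hv : (es.map Prod.snd).count v = 1) :
    ∃ a c es', es = (a, v) ::ₘ (v, c) ::ₘ es' ∧ ∀ e ∈ es', e.1 ≠ v ∧ e.2 ≠ v := by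
  have hm : v ∈ es.map Prod.snd := Multiset.count_pos.mp (by omega)
  have hm' : v ∈ es.map Prod.fst := h.balanced ▸ hm
  obtain ⟨⟨a, v'⟩, he, rfl⟩ := Multiset.mem_map.mp hm
  obtain ⟨⟨v'', c⟩, he', hv''⟩ := Multiset.mem_map.mp hm'
  simp only at hv'' hv
  subst hv''
  obtain ⟨es1, rfl⟩ := Multiset.exists_cons_of_mem he
  have hav := h.loopless _ he
  have hvc := h.loopless _ he'
  simp only at hav hvc
  have he1 : (v'', c) ∈ es1 := by
    rcases Multiset.mem_cons.mp he' with h1 | h1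
    · exact absurd (congrArg Prod.fst h1).symm hav
    · exact h1
  obtain ⟨es2, rfl⟩ := Multiset.exists_cons_of_mem he1
  refine ⟨a, c, es2, rfl, ?_⟩
  have hb := hv
  rw [← h.balanced] at hb
  simp only [Multiset.map_cons, Multiset.count_cons, if_true, hav.symm, hvc, if_false,
    Nat.add_eq_right, Nat.add_zero] at hv hb
  rw [Multiset.count_eq_zero] at hv hb
  intro e he
  exact ⟨fun h => hb (Multiset.mem_map.mpr ⟨e, he, h⟩),
    fun h => hv (Multiset.mem_map.mpr ⟨e, he, h⟩)⟩

lemma count_pos (h : RootedFlow R U es) {v : I} (hv : v ∈ U) :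
    1 ≤ (es.map Prod.snd).count v := by
  obtain ⟨e, he, -, h2⟩ := h.cut {v} (by simpa using hv) (by simp)
  rw [Finset.mem_singleton] at h2
  exact Multiset.count_pos.mpr (h2 ▸ Multiset.mem_map_of_mem _ he)

/-- The surplus edge comes from the cut at `U`: some edge enters `U` from outside, and by balance
its source has an incoming edge too, beyond the `2 |U|` edges that end in `U`. -/
lemma two_mul_card_lt (h : RootedFlow R U es) (hes : es ≠ 0)
    (h2 : ∀ v ∈ U, 2 ≤ (es.map Prod.snd).count v) : 2 * U.card + 1 ≤ es.card := by
  rcases U.eq_empty_or_nonempty with rfl | hU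
  · simpa [Nat.succ_le_iff] using Multiset.card_pos.mpr hes
  · obtain ⟨e, he, h1, -⟩ := h.cut U subset_rfl hU
    have he1 : e.1 ∈ es.map Prod.snd := h.balanced ▸ Multiset.mem_map_of_mem _ he
    have hsub : insert e.1 U ⊆ (es.map Prod.snd).toFinset := by
      intro w hw
      rw [Multiset.mem_toFinset]
      rcases Finset.mem_insert.mp hw with rfl | hw
      · exact he1
      · exact Multiset.count_pos.mp (by have := h2 w hw; omega)
    calc 2 * U.card + 1 = (∑ _w ∈ U, 2) + 1 := by rw [Finset.sum_const, smul_eq_mul, mul_comm]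
      _ ≤ (∑ w ∈ U, (es.map Prod.snd).count w) + (es.map Prod.snd).count e.1 :=
        add_le_add (Finset.sum_le_sum h2) (Multiset.count_pos.mpr he1)
      _ = ∑ w ∈ insert e.1 U, (es.map Prod.snd).count w := by
        rw [Finset.sum_insert h1, add_comm]
      _ ≤ ∑ w ∈ (es.map Prod.snd).toFinset, (es.map Prod.snd).count w :=
        Finset.sum_le_sum_of_subset hsub
      _ = es.card := by rw [Multiset.toFinset_sum_count_eq, Multiset.card_map]

section Remove

variable {a v c : I}

lemma remove_balanced (h : RootedFlow R U ((a, v) ::ₘ (v, c) ::ₘ es)) :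
    ((a, c) ::ₘ es).map Prod.fst = ((a, c) ::ₘ es).map Prod.snd := by
  have := h.balanced
  simp only [Multiset.map_cons] at this ⊢
  rw [Multiset.cons_swap, Multiset.cons_inj_right] at this
  exact this

lemma remove_cut (h : RootedFlow R U ((a, v) ::ₘ (v, c) ::ₘ es)) (hv : v ∈ U)
    (hes : ∀ e ∈ es, e.1 ≠ v ∧ e.2 ≠ v) (W : Finset I) (hW : W ⊆ U.erase v)
    (hne : W.Nonempty) : ∃ e ∈ (a, c) ::ₘ es, e.1 ∉ W ∧ e.2 ∈ W := by
  have hvW : v ∉ W := fun hvW => (Finset.mem_erase.mp (hW hvW)).1 rfl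
  -- The removed vertex is put on the side of its predecessor. If `a ∈ W`, the cut is taken at
  -- `insert v W`, which neither `(a, v)` nor `(v, c)` enters from outside.
  by_cases ha : a ∈ W
  · obtain ⟨e, he, h1, h2⟩ := h.cut (insert v W) (Finset.insert_subset hv
      (hW.trans (Finset.erase_subset _ _))) (Finset.insert_nonempty _ _)
    simp only [Multiset.mem_cons] at he
    rcases he with rfl | rfl | he
    · exact absurd (Finset.mem_insert_of_mem ha) h1
    · exact absurd (Finset.mem_insert_self _ _) h1
    · exact ⟨e, Multiset.mem_cons_of_mem he, fun h4 => h1 (Finset.mem_insert_of_mem h4),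
        (Finset.mem_insert.mp h2).resolve_left (hes e he).2⟩
  · obtain ⟨e, he, h1, h2⟩ := h.cut W (hW.trans (Finset.erase_subset _ _)) hne
    simp only [Multiset.mem_cons] at he
    rcases he with rfl | rfl | he
    · exact absurd h2 hvW
    · exact ⟨(a, c), Multiset.mem_cons_self _ _, ha, h2⟩
    · exact ⟨e, Multiset.mem_cons_of_mem he, h1, h2⟩

lemma remove_mem (h : RootedFlow R U ((a, v) ::ₘ (v, c) ::ₘ es)) :
    (a ∈ R ∪ U.erase v ∧ c ∈ R ∪ U.erase v) ∧ a ≠ v ∧ c ≠ v := by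
  have hav : a ≠ v := h.loopless (a, v) (by simp)
  have hvc : v ≠ c := h.loopless (v, c) (by simp)
  have ha := (h.mem (a, v) (by simp)).1
  have hc := (h.mem (v, c) (by simp)).2
  simp only [Finset.mem_union, Finset.mem_erase] at ha hc ⊢
  tauto

lemma remove_mem_of_untouched (h : RootedFlow R U ((a, v) ::ₘ (v, c) ::ₘ es))
    (hes : ∀ e ∈ es, e.1 ≠ v ∧ e.2 ≠ v) :
    ∀ e ∈ es, e.1 ∈ R ∪ U.erase v ∧ e.2 ∈ R ∪ U.erase v := by
  intro e he
  have h1 := h.mem e (by simp [he])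
  have h2 := hes e he
  simp only [Finset.mem_union, Finset.mem_erase] at h1 ⊢
  tauto

lemma shortcut (h : RootedFlow R U ((a, v) ::ₘ (v, c) ::ₘ es)) (hv : v ∈ U)
    (hes : ∀ e ∈ es, e.1 ≠ v ∧ e.2 ≠ v) (hac : a ≠ c) :
    RootedFlow R (U.erase v) ((a, c) ::ₘ es) where
  disj := h.disj.mono_right (Finset.erase_subset _ _)
  loopless := by
    intro e he
    rcases Multiset.mem_cons.mp he with rfl | he
    · exact hac
    · exact h.loopless e (by simp [he])
  mem := by
    intro e he
    rcases Multiset.mem_cons.mp he with rfl | he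
    · exact h.remove_mem.1
    · exact h.remove_mem_of_untouched hes e he
  balanced := h.remove_balanced
  cut := h.remove_cut hv hes

lemma prune (h : RootedFlow R U ((a, v) ::ₘ (v, a) ::ₘ es)) (hv : v ∈ U)
    (hes : ∀ e ∈ es, e.1 ≠ v ∧ e.2 ≠ v) :
    RootedFlow R (U.erase v) es where
  disj := h.disj.mono_right (Finset.erase_subset _ _)
  loopless := fun e he => h.loopless e (by simp [he])
  mem := h.remove_mem_of_untouched hes
  balanced := by simpa using h.remove_balanced
  cut := by
    intro W hW hne
    obtain ⟨e, he, h1, h2⟩ := h.remove_cut hv hes W hW hne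
    rcases Multiset.mem_cons.mp he with rfl | he
    · exact absurd h2 h1
    · exact ⟨e, he, h1, h2⟩

/-- This is the multigraph of a collision term, with `v` identified with `w`. If `a → c` would enter
a set, then `a → w` or `w → c` enters it. -/
lemma merge (h : RootedFlow R U ((a, v) ::ₘ (v, c) ::ₘ es)) (hv : v ∈ U)
    (hes : ∀ e ∈ es, e.1 ≠ v ∧ e.2 ≠ v) {w : I} (hw : w ∈ R ∪ U) (hwv : w ≠ v) (hwa : w ≠ a)
    (hwc : w ≠ c) :
    RootedFlow R (U.erase v) ((a, w) ::ₘ (w, c) ::ₘ es) where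
  disj := h.disj.mono_right (Finset.erase_subset _ _)
  loopless := by
    intro e he
    simp only [Multiset.mem_cons] at he
    rcases he with rfl | rfl | he
    · exact hwa.symm
    · exact hwc
    · exact h.loopless e (by simp [he])
  mem := by
    have hw' : w ∈ R ∪ U.erase v := by
      simp only [Finset.mem_union, Finset.mem_erase] at hw ⊢
      tauto
    intro e he
    simp only [Multiset.mem_cons] at he
    rcases he with rfl | rfl | he
    · exact ⟨h.remove_mem.1.1, hw'⟩
    · exact ⟨hw', h.remove_mem.1.2⟩
    · exact h.remove_mem_of_untouched hes e he
  balanced := by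
    have := h.remove_balanced
    simp only [Multiset.map_cons] at this ⊢
    rw [Multiset.cons_swap, this]
  cut := by
    intro W hW hne
    obtain ⟨e, he, h1, h2⟩ := h.remove_cut hv hes W hW hne
    rcases Multiset.mem_cons.mp he with rfl | he
    · by_cases hwW : w ∈ W
      · exact ⟨(a, w), by simp, h1, hwW⟩
      · exact ⟨(w, c), by simp, hwW, h2⟩
    · exact ⟨e, by simp [he], h1, h2⟩

end Remove
end RootedFlow

/-- The sizes for which the moment estimates hold: `n` vectors from `x` bases in dimension `p`,
with `η` bounding the error terms. -/
structure SparseRegime (K : ℕ) (n p x η : ℝ) : Prop where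
  one_le : 1 ≤ n
  le_dim : n ≤ p
  pos : 0 < x
  two_mul_le : 2 * K ≤ x
  le_one : η ≤ 1
  sqrt_le : √(n / p) ≤ η
  inv_sqrt_le : 1 / √n ≤ η
  inv_le : 1 / x ≤ η

/-- The average of the kernel over a multigraph, scaled by `n ^ |U| * (p / n) ^ (|es| / 2)`. -/
noncomputable def scaledAvg (g : D → D → ℂ) (p : ℝ) (U : Finset I) (es : Multiset (I × I)) : ℂ :=
  ((Fintype.card I : ℝ) ^ U.card * √(p / Fintype.card I) ^ es.card : ℝ) * embAvg (edgeProd g es)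

lemma SparseRegime.eta_nonneg {K : ℕ} {n p x η : ℝ} (h : SparseRegime K n p x η) : 0 ≤ η :=
  (Real.sqrt_nonneg _).trans h.sqrt_le

section Bounds

variable {g : D → D → ℂ} {μ p x η : ℝ} {K : ℕ} {R U : Finset I} {es : Multiset (I × I)}

/-- The powers of `p` cancel: the trivial bound `(μ / √p) ^ |es|` leaves `μ ^ |es| * √n ^ (2 |U| -
|es|)`. -/
lemma norm_scaledAvg_le_of_two_mul_le (hg : IsCoherentKernel g μ p x) (hμ : 0 ≤ μ)
    (hr : SparseRegime K (Fintype.card I) p x η) (h : ∀ e ∈ es, e.1 ≠ e.2)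
    {d : ℕ} (hU : 2 * U.card + d ≤ es.card) (hK : es.card ≤ K) :
    ‖scaledAvg g p U es‖ ≤ max 1 μ ^ K * (1 / √(Fintype.card I : ℝ)) ^ d := by
  set n : ℝ := ((Fintype.card I : ℕ) : ℝ) with hn
  have hn1 : 1 ≤ n := hr.one_le
  have hn0 : 0 < n := by linarith
  have hp : 0 < p := by linarith [hr.le_dim]
  have hs1 : 1 ≤ √n := Real.one_le_sqrt.mpr hn1
  have hs0 : 0 < √n := by linarith
  have hsp : 0 < √p := Real.sqrt_pos.mpr hp
  have h1 : ‖embAvg (edgeProd g es)‖ ≤ (μ / √p) ^ es.card :=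
    norm_embAvg_le _ (by positivity) (norm_edgeProd_le hg es h)
  have h2 : n ^ U.card * √(p / n) ^ es.card * (μ / √p) ^ es.card =
      μ ^ es.card * (√n ^ (2 * U.card) / √n ^ es.card) := by
    rw [pow_mul, Real.sq_sqrt hn0.le, Real.sqrt_div hp.le, div_pow, div_pow]
    field_simp
  have h3 : √n ^ (2 * U.card) / √n ^ es.card ≤ (1 / √n) ^ d := by
    rw [one_div, inv_pow, div_le_iff₀ (by positivity), ← div_eq_inv_mul,
      le_div_iff₀ (by positivity), ← pow_add]
    exact pow_le_pow_right₀ hs1 hU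
  have h4 : μ ^ es.card ≤ max 1 μ ^ K :=
    (pow_le_pow_left₀ hμ (le_max_right _ _) _).trans (pow_le_pow_right₀ (le_max_left _ _) hK)
  unfold scaledAvg
  rw [norm_mul, Complex.norm_real, Real.norm_of_nonneg (by positivity), ← hn]
  calc _ ≤ n ^ U.card * √(p / n) ^ es.card * (μ / √p) ^ es.card := by gcongr
    _ = _ := h2
    _ ≤ _ := by gcongr

/-- The multigraph obtained by removing a vertex between `a` and `c`, without a loop. -/
def bridge (a c : I) (es : Multiset (I × I)) : Multiset (I × I) :=
  if a = c then es else (a, c) ::ₘ es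

/-- Collisions of `v` with `a` or `c` create a loop of weight one and so reproduce the main term.
They account for the `1` or `2` subtracted from `x`. -/
lemma embAvg_bridge (hg : IsCoherentKernel g μ p x) {a v c : I} (hav : a ≠ v) (hcv : c ≠ v)
    {V : Finset I} (hv : v ∈ V) (ha : a ∈ V) (hc : c ∈ V) (es : Multiset (I × I))
    (hes : ∀ e ∈ es, (e.1 ∈ V ∧ e.1 ≠ v) ∧ (e.2 ∈ V ∧ e.2 ≠ v)) :
    ((x : ℂ) * p - V.card + 1) * embAvg (edgeProd g ((a, v) ::ₘ (v, c) ::ₘ es)) =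
      (x - (if a = c then 1 else 2)) * embAvg (edgeProd g (bridge a c es)) -
        ∑ w ∈ ((V.erase v).erase a).erase c,
          embAvg (edgeProd g ((a, w) ::ₘ (w, c) ::ₘ es)) := by
  have h := embAvg_edgeProd_resample hg V hv ha hc hav hcv es hes
  have hloop : ∀ es : Multiset (I × I), edgeProd g ((c, c) ::ₘ es) = edgeProd g es :=
    edgeProd_loop hg.diag c
  rw [← Finset.add_sum_erase _ _ (Finset.mem_erase.mpr ⟨hav, ha⟩), edgeProd_loop hg.diag] at h
  unfold bridge
  by_cases hac : a = c
  · subst hac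
    rw [edgeProd_loop hg.diag] at h
    rw [if_pos rfl, if_pos rfl, Finset.erase_idem]
    linear_combination -h
  · rw [← Finset.add_sum_erase _ _ (Finset.mem_erase.mpr ⟨Ne.symm hac,
      Finset.mem_erase.mpr ⟨hcv, hc⟩⟩), Multiset.cons_swap (a, c), hloop] at h
    rw [if_neg hac, if_neg hac]
    linear_combination -h

/-- Rescale `embAvg_bridge` and divide by its coefficient `d`, which is of order `x p`. Pruning has
the factor `p (x - 1) / d = 1 + O(1 / x)`, the shortcut has `(x - 2) n √(p / n) / d = O(√(n / p))`,
and each of the at most `K` collisions has `n / d = O(1 / x)` because `n ≤ p`. -/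
lemma norm_scaledAvg_sub_le (hg : IsCoherentKernel g μ p x)
    (hr : SparseRegime K (Fintype.card I) p x η) {a v c : I}
    (h : RootedFlow R U ((a, v) ::ₘ (v, c) ::ₘ es)) (hv : v ∈ U)
    (hes : ∀ e ∈ es, e.1 ≠ v ∧ e.2 ≠ v) (hK : (R ∪ U).card ≤ K) {C : ℝ}
    (h1 : ‖scaledAvg g p (U.erase v) (bridge a c es)‖ ≤ C)
    (h2 : ∀ w ∈ R ∪ U, w ≠ v → w ≠ a → w ≠ c →
      ‖scaledAvg g p (U.erase v) ((a, w) ::ₘ (w, c) ::ₘ es)‖ ≤ C) :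
    ‖scaledAvg g p U ((a, v) ::ₘ (v, c) ::ₘ es) -
      (if a = c then scaledAvg g p (U.erase v) es else 0)‖ ≤ (4 * K + 2) * η * C := by
  set n : ℝ := ((Fintype.card I : ℕ) : ℝ) with hn
  have hn1 : 1 ≤ n := hr.one_le
  have hn0 : 0 < n := by linarith
  have hnp := hr.le_dim
  have hp : 0 < p := by linarith
  have hx := hr.pos
  have hC : 0 ≤ C := (norm_nonneg _).trans h1
  have hη := hr.eta_nonneg
  obtain ⟨⟨ha, hc⟩, hav, hcv⟩ := h.remove_mem
  have hsub : R ∪ U.erase v ⊆ R ∪ U := Finset.union_subset_union_right (Finset.erase_subset _ _)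
  have hvV : v ∈ R ∪ U := Finset.mem_union_right _ hv
  have key := embAvg_bridge hg hav hcv hvV (hsub ha) (hsub hc) es (fun e he =>
    ⟨⟨(h.mem e (by simp [he])).1, (hes e he).1⟩, ⟨(h.mem e (by simp [he])).2, (hes e he).2⟩⟩)
  set rest := (((R ∪ U).erase v).erase a).erase c with hrest
  set m : ℝ := (((R ∪ U).card : ℕ) : ℝ) with hm
  have hmK : m ≤ K := by rw [hm]; exact_mod_cast hK
  have hm0 : 0 ≤ m := by positivity
  have hrestK : (rest.card : ℝ) ≤ K := by
    have : rest.card ≤ (R ∪ U).card :=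
      ((Finset.card_erase_le).trans Finset.card_erase_le).trans Finset.card_erase_le
    exact_mod_cast this.trans hK
  set d : ℝ := x * p - m + 1 with hd
  -- The field `two_mul_le` serves here: `m ≤ K ≤ x / 2 ≤ x p / 2`.
  have hdx : x * p / 2 ≤ d := by
    have : x ≤ x * p := le_mul_of_one_le_right hx.le (by linarith)
    have := hr.two_mul_le
    linarith
  have hxp : 0 < x * p := by positivity
  have hd0 : 0 < d := by linarith
  have hcard : U.card = (U.erase v).card + 1 := (Finset.card_erase_add_one hv).symm
  set A := embAvg (edgeProd g ((a, v) ::ₘ (v, c) ::ₘ es)) with hA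
  have hq : √(p / n) ^ 2 = p / n := Real.sq_sqrt (by positivity)
  -- Since `1 ≤ η x`, every error of order `p` becomes a multiple of `η d`.
  have hpd : p ≤ 2 * η * d := by
    have h3 : 1 ≤ η * x := by
      have := hr.inv_le
      rwa [div_le_iff₀ hx] at this
    nlinarith
  have hm1 : 1 ≤ m := by
    rw [hm]; exact_mod_cast Finset.card_pos.mpr ⟨v, hvV⟩
  set T1 := scaledAvg g p (U.erase v) (bridge a c es) with hT1
  set Tw := fun w => scaledAvg g p (U.erase v) ((a, w) ::ₘ (w, c) ::ₘ es) with hTw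
  have hsum : ‖∑ w ∈ rest, Tw w‖ ≤ K * C := by
    refine (norm_sum_le _ _).trans ((Finset.sum_le_card_nsmul _ _ C ?_).trans ?_)
    · intro w hw
      simp only [hrest, Finset.mem_erase] at hw
      exact h2 w hw.2.2.2 hw.2.2.1 hw.2.1 hw.1
    · rw [nsmul_eq_mul]
      gcongr
  have hnsum : ‖(n : ℂ) * ∑ w ∈ rest, Tw w‖ ≤ p * (K * C) := by
    rw [norm_mul, Complex.norm_real, Real.norm_of_nonneg hn0.le]
    gcongr
  have hsum' : ∑ w ∈ rest, Tw w = ((n ^ (U.erase v).card * √(p / n) ^ (es.card + 2) : ℝ) : ℂ) *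
      ∑ w ∈ rest, embAvg (edgeProd g ((a, w) ::ₘ (w, c) ::ₘ es)) := by
    rw [Finset.mul_sum]
    refine Finset.sum_congr rfl fun w _ => ?_
    simp only [hTw, scaledAvg, Multiset.card_cons, ← hn]
  have hT : scaledAvg g p U ((a, v) ::ₘ (v, c) ::ₘ es) =
      ((n ^ ((U.erase v).card + 1) * √(p / n) ^ (es.card + 2) : ℝ) : ℂ) * A := by
    simp only [scaledAvg, Multiset.card_cons, ← hn, hcard, hA]
  have hkey : (d : ℂ) * A = (x - (if a = c then 1 else 2)) * embAvg (edgeProd g (bridge a c es)) -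
        ∑ w ∈ rest, embAvg (edgeProd g ((a, w) ::ₘ (w, c) ::ₘ es)) := by
    rw [← key, hd, hm]
    push_cast
    ring
  have hfin : ∀ z : ℂ, ‖(d : ℂ) * z‖ ≤ (4 * K + 2) * (η * d) * C →
      ‖z‖ ≤ (4 * K + 2) * η * C := by
    intro z hz
    rw [norm_mul, Complex.norm_real, Real.norm_of_nonneg hd0.le] at hz
    refine le_of_mul_le_mul_left ?_ hd0
    linarith
  apply hfin
  have hqc : ((√(p / n) : ℝ) : ℂ) ^ 2 * n = p := by
    have : √(p / n) ^ 2 * n = p := by rw [hq]; field_simp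
    exact_mod_cast congrArg (fun r : ℝ => (r : ℂ)) this
  by_cases hac : a = c
  · have hb : bridge a c es = es := if_pos hac
    rw [if_pos hac] at hkey ⊢
    rw [hb] at hT1 hkey
    have hT1' : T1 = ((n ^ (U.erase v).card * √(p / n) ^ es.card : ℝ) : ℂ) *
        embAvg (edgeProd g es) := hT1
    have e1 : (d : ℂ) * (scaledAvg g p U ((a, v) ::ₘ (v, c) ::ₘ es) -
        scaledAvg g p (U.erase v) es) = ((m - 1 - p : ℝ) : ℂ) * T1 - n * ∑ w ∈ rest, Tw w := by
      have : (d : ℂ) * T1 = (x * p - m + 1) * T1 := by rw [hd]; push_cast; ring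
      rw [mul_sub, ← hT1, this, hT, mul_left_comm, hkey, hsum', hT1']
      push_cast
      rw [pow_succ _ (U.erase v).card, pow_add _ es.card 2]
      linear_combination (n : ℂ) ^ (U.erase v).card * ((√(p / n) : ℝ) : ℂ) ^ es.card * (x - 1) *
        embAvg (edgeProd g es) * hqc
    rw [e1]
    have h3 : ‖((m - 1 - p : ℝ) : ℂ) * T1‖ ≤ ((K + 1) * p) * C := by
      rw [norm_mul, Complex.norm_real]
      refine mul_le_mul ?_ h1 (norm_nonneg _) (by positivity)
      have hp1 : 1 ≤ p := hn1.trans hnp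
      rw [Real.norm_eq_abs, abs_le]
      constructor <;> nlinarith
    refine (norm_sub_le _ _).trans ((add_le_add h3 hnsum).trans ?_)
    have h4 : (2 * K + 1) * p * C ≤ (2 * K + 1) * (2 * η * d) * C := by gcongr
    linarith
  · have hb : bridge a c es = (a, c) ::ₘ es := if_neg hac
    rw [if_neg hac] at hkey ⊢
    rw [hb] at hT1 hkey
    have hT1' : T1 = ((n ^ (U.erase v).card * √(p / n) ^ (es.card + 1) : ℝ) : ℂ) *
        embAvg (edgeProd g ((a, c) ::ₘ es)) := by
      rw [hT1, scaledAvg, Multiset.card_cons]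
    have e1 : (d : ℂ) * (scaledAvg g p U ((a, v) ::ₘ (v, c) ::ₘ es) - 0) =
        (((x - 2) * (n * √(p / n)) : ℝ) : ℂ) * T1 - n * ∑ w ∈ rest, Tw w := by
      rw [sub_zero, hT, mul_left_comm, hkey, hsum', hT1']
      push_cast
      ring
    rw [e1]
    have hx2 : 2 ≤ x := by linarith [hr.two_mul_le]
    have h4 : n * √(p / n) = p * √(n / p) := by
      rw [Real.sqrt_div hp.le, Real.sqrt_div hn0.le]
      have := Real.mul_self_sqrt hp.le
      have := Real.mul_self_sqrt hn0.le
      have : 0 < √p := Real.sqrt_pos.mpr hp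
      have : 0 < √n := Real.sqrt_pos.mpr hn0
      field_simp
      nlinarith
    have h5 : ‖(((x - 2) * (n * √(p / n)) : ℝ) : ℂ) * T1‖ ≤ p * (x * η) * C := by
      rw [norm_mul, Complex.norm_real, h4, Real.norm_of_nonneg (by
        have := Real.sqrt_nonneg (n / p)
        have : 0 ≤ x - 2 := by linarith
        positivity)]
      refine mul_le_mul ?_ h1 (norm_nonneg _) (by positivity)
      have := hr.sqrt_le
      have h6 : (x - 2) * (p * √(n / p)) ≤ x * (p * η) := by
        gcongr
        linarith
      linarith
    refine (norm_sub_le _ _).trans ((add_le_add h5 hnsum).trans ?_)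
    have h7 : (K : ℝ) * p * C ≤ K * (2 * η * d) * C := by gcongr
    have h8 : x * p * (η * C) ≤ 2 * d * (η * C) :=
      mul_le_mul_of_nonneg_right (by linarith) (by positivity)
    have h9 : 0 ≤ K * (η * d * C) := by positivity
    linarith

lemma card_bridge_le (a v c : I) (es : Multiset (I × I)) :
    (bridge a c es).card ≤ ((a, v) ::ₘ (v, c) ::ₘ es).card := by
  unfold bridge
  split_ifs <;> simp only [Multiset.card_cons] <;> omega

lemma RootedFlow.bridge {a v c : I} (h : RootedFlow R U ((a, v) ::ₘ (v, c) ::ₘ es)) (hv : v ∈ U)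
    (hes : ∀ e ∈ es, e.1 ≠ v ∧ e.2 ≠ v) : RootedFlow R (U.erase v) (bridge a c es) := by
  unfold _root_.bridge
  split_ifs with hac
  · subst hac
    exact h.prune hv hes
  · exact h.shortcut hv hes hac

/-- Induction on the number of free vertices. Eliminating one of in-degree one leads to flows with
one free vertex fewer and costs a factor `(4 K + 2) η + 1 ≤ 4 K + 4`. If there is none, the
coherence bound applies. -/
lemma norm_scaledAvg_le (hg : IsCoherentKernel g μ p x) (hμ : 0 ≤ μ)
    (hr : SparseRegime K (Fintype.card I) p x η) (h : RootedFlow R U es)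
    (hV : (R ∪ U).card ≤ K) (hK : es.card ≤ K) :
    ‖scaledAvg g p U es‖ ≤ max 1 μ ^ K * (4 * K + 4) ^ U.card := by
  have hM : (1 : ℝ) ≤ max 1 μ ^ K := one_le_pow₀ (le_max_left _ _)
  induction hk : U.card generalizing U es with
  | zero =>
    have := norm_scaledAvg_le_of_two_mul_le hg hμ hr h.loopless (d := 0) (U := U)
      (by omega) hK
    simpa using this
  | succ k ih =>
    by_cases h2 : ∀ v ∈ U, 2 ≤ (es.map Prod.snd).count v
    · have hne : es ≠ 0 := by
        rintro rfl
        obtain ⟨v, hv⟩ := Finset.card_pos.mp (by omega : 0 < U.card)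
        simpa using h2 v hv
      have := h.two_mul_card_lt hne h2
      refine (norm_scaledAvg_le_of_two_mul_le hg hμ hr h.loopless (d := 0) (U := U)
        (by omega) hK).trans ?_
      rw [pow_zero]
      gcongr
      exact one_le_pow₀ (by linarith [(Nat.cast_nonneg K : (0 : ℝ) ≤ K)])
    · push Not at h2
      obtain ⟨v, hv, h2⟩ := h2
      obtain ⟨a, c, es', rfl, hes⟩ := h.exists_split
        (by have := h.count_pos hv; omega : (es.map Prod.snd).count v = 1)
      have hk' : (U.erase v).card = k := by rw [Finset.card_erase_of_mem hv]; omega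
      have hV' : (R ∪ U.erase v).card ≤ K := (Finset.card_le_card
        (Finset.union_subset_union_right (Finset.erase_subset _ _))).trans hV
      have h1 := ih (h.bridge hv hes) hV' ((card_bridge_le a v c es').trans hK) hk'
      set C : ℝ := max 1 μ ^ K * (4 * K + 4) ^ k with hC
      have hC0 : 0 ≤ C := by positivity
      have hsub := norm_scaledAvg_sub_le hg hr h hv hes hV h1 (fun w hw hwv hwa hwc =>
        ih (h.merge hv hes hw hwv hwa hwc) hV' (by simpa using hK) hk')
      have hite : ‖(if a = c then scaledAvg g p (U.erase v) es' else 0)‖ ≤ C := by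
        split_ifs with hac
        · rwa [_root_.bridge, if_pos hac] at h1
        · simpa using hC0
      have h3 := norm_le_norm_sub_add (scaledAvg g p U ((a, v) ::ₘ (v, c) ::ₘ es'))
        (if a = c then scaledAvg g p (U.erase v) es' else 0)
      have h4 : (4 * K + 2) * η * C ≤ (4 * K + 2) * 1 * C := by
        gcongr
        exact hr.le_one
      rw [pow_succ, ← mul_assoc, ← hC]
      linarith

/-- A uniform bound for the scaled averages. -/
noncomputable def flowBound (μ : ℝ) (K : ℕ) : ℝ := max 1 μ ^ K * (4 * K + 4) ^ K

lemma one_le_flowBound (μ : ℝ) (K : ℕ) : 1 ≤ flowBound μ K :=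
  one_le_mul_of_one_le_of_one_le (one_le_pow₀ (le_max_left _ _))
    (one_le_pow₀ (by linarith [(Nat.cast_nonneg K : (0 : ℝ) ≤ K)]))

lemma norm_scaledAvg_le_flowBound (hg : IsCoherentKernel g μ p x) (hμ : 0 ≤ μ)
    (hr : SparseRegime K (Fintype.card I) p x η) (h : RootedFlow R U es)
    (hV : (R ∪ U).card ≤ K) (hK : es.card ≤ K) : ‖scaledAvg g p U es‖ ≤ flowBound μ K := by
  refine (norm_scaledAvg_le hg hμ hr h hV hK).trans ?_
  unfold flowBound
  gcongr
  · linarith [(Nat.cast_nonneg K : (0 : ℝ) ≤ K)]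
  · exact (Finset.card_le_card Finset.subset_union_right).trans hV

/-- The argument gives `max 1 μ ^ K * η`. This is enlarged to the error of one vertex removal, so
that a single error size serves throughout the later induction. -/
lemma norm_scaledAvg_le_of_two_le_count (hg : IsCoherentKernel g μ p x) (hμ : 0 ≤ μ)
    (hr : SparseRegime K (Fintype.card I) p x η) (h : RootedFlow R U es) (hK : es.card ≤ K)
    (hes : es ≠ 0) (h2 : ∀ v ∈ U, 2 ≤ (es.map Prod.snd).count v) :
    ‖scaledAvg g p U es‖ ≤ (4 * K + 2) * η * flowBound μ K := by
  have h1 := norm_scaledAvg_le_of_two_mul_le hg hμ hr h.loopless (h.two_mul_card_lt hes h2) hK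
  rw [pow_one] at h1
  have hη := hr.eta_nonneg
  have hB : max 1 μ ^ K ≤ flowBound μ K :=
    le_mul_of_one_le_right (by positivity)
      (one_le_pow₀ (by linarith [(Nat.cast_nonneg K : (0 : ℝ) ≤ K)]))
  have hB0 : 0 ≤ flowBound μ K := zero_le_one.trans (one_le_flowBound μ K)
  calc _ ≤ max 1 μ ^ K * η := h1.trans (by gcongr; exact hr.inv_sqrt_le)
    _ ≤ flowBound μ K * η := by gcongr
    _ ≤ (4 * K + 2) * (flowBound μ K * η) :=
      le_mul_of_one_le_left (by positivity) (by linarith [(Nat.cast_nonneg K : (0 : ℝ) ≤ K)])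
    _ = _ := by ring

lemma norm_scaledAvg_sub_le_flowBound (hg : IsCoherentKernel g μ p x) (hμ : 0 ≤ μ)
    (hr : SparseRegime K (Fintype.card I) p x η) {a v c : I}
    (h : RootedFlow R U ((a, v) ::ₘ (v, c) ::ₘ es)) (hv : v ∈ U)
    (hes : ∀ e ∈ es, e.1 ≠ v ∧ e.2 ≠ v) (hV : (R ∪ U).card ≤ K)
    (hK : ((a, v) ::ₘ (v, c) ::ₘ es).card ≤ K) :
    ‖scaledAvg g p U ((a, v) ::ₘ (v, c) ::ₘ es) -
      (if a = c then scaledAvg g p (U.erase v) es else 0)‖ ≤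
        (4 * K + 2) * η * flowBound μ K := by
  have hV' : (R ∪ U.erase v).card ≤ K := (Finset.card_le_card
    (Finset.union_subset_union_right (Finset.erase_subset _ _))).trans hV
  exact norm_scaledAvg_sub_le hg hr h hv hes hV
    (norm_scaledAvg_le_flowBound hg hμ hr (h.bridge hv hes) hV'
      ((card_bridge_le a v c es).trans hK))
    (fun w hw hwv hwa hwc => norm_scaledAvg_le_flowBound hg hμ hr
      (h.merge hv hes hw hwv hwa hwc) hV' (by simpa using hK))

end Bounds
end Flows

/-! ### Closed walks as lists, and depth-first traversals of trees. -/

section Words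

variable {I : Type*} [DecidableEq I]

/-- The directed edges of the walk that starts at a vertex and visits the entries of a list. -/
def chainEdges : I → List I → Multiset (I × I)
  | _, [] => 0
  | x, y :: t => (x, y) ::ₘ chainEdges y t

lemma getLastD_append' (t s : List I) (x : I) :
    (t ++ s).getLastD x = s.getLastD (t.getLastD x) := by
  induction t generalizing x with
  | nil => rfl
  | cons y t ih => rw [List.cons_append, List.getLastD_cons, List.getLastD_cons, ih]

lemma getLastD_mem_cons (t : List I) (x : I) : t.getLastD x ∈ x :: t := by
  induction t generalizing x with
  | nil => simp
  | cons y t ih => rw [List.getLastD_cons]; exact List.mem_cons_of_mem _ (ih y)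

lemma chainEdges_append (x : I) (t s : List I) :
    chainEdges x (t ++ s) = chainEdges x t + chainEdges (t.getLastD x) s := by
  induction t generalizing x with
  | nil => simp [chainEdges]
  | cons y t ih => rw [List.cons_append, chainEdges, chainEdges, ih, List.getLastD_cons,
      Multiset.cons_add]

lemma map_snd_chainEdges (x : I) (t : List I) : (chainEdges x t).map Prod.snd = t := by
  induction t generalizing x with
  | nil => simp [chainEdges]
  | cons y t ih => rw [chainEdges, Multiset.map_cons, ih, Multiset.cons_coe]

/-- Sources omit the final vertex of the walk and targets the initial one. With the missing vertices
restored, balance of a closed walk follows by cancellation. -/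
lemma cons_map_fst_chainEdges (x : I) (t : List I) :
    t.getLastD x ::ₘ (chainEdges x t).map Prod.fst = x ::ₘ (t : Multiset I) := by
  induction t generalizing x with
  | nil => simp [chainEdges]
  | cons y t ih =>
    rw [chainEdges, Multiset.map_cons, List.getLastD_cons, Multiset.cons_swap, ih,
      Multiset.cons_coe y]

lemma card_chainEdges (x : I) (t : List I) : (chainEdges x t).card = t.length := by
  rw [← Multiset.card_map Prod.snd, map_snd_chainEdges, Multiset.coe_card]

lemma chainEdges_balanced {x : I} {t : List I} (h : t.getLastD x = x) :
    (chainEdges x t).map Prod.fst = (chainEdges x t).map Prod.snd := by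
  have := cons_map_fst_chainEdges x t
  rw [h, Multiset.cons_inj_right] at this
  rw [this, map_snd_chainEdges]

lemma mem_of_mem_chainEdges {x : I} {t : List I} {e : I × I} (he : e ∈ chainEdges x t) :
    e.1 ∈ x :: t ∧ e.2 ∈ t := by
  constructor
  · have h : e.1 ∈ t.getLastD x ::ₘ (chainEdges x t).map Prod.fst :=
      Multiset.mem_cons_of_mem (Multiset.mem_map_of_mem _ he)
    rw [cons_map_fst_chainEdges] at h
    exact h
  · have h := Multiset.mem_map_of_mem Prod.snd he
    rw [map_snd_chainEdges] at h
    exact h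

lemma chainEdges_cut {W : Finset I} {x : I} {t : List I} (hx : x ∉ W) {z : I} (hz : z ∈ t)
    (hzW : z ∈ W) : ∃ e ∈ chainEdges x t, e.1 ∉ W ∧ e.2 ∈ W := by
  induction t generalizing x with
  | nil => simp at hz
  | cons y t ih =>
    by_cases hy : y ∈ W
    · exact ⟨(x, y), Multiset.mem_cons_self _ _, hx, hy⟩
    · rcases List.mem_cons.mp hz with rfl | hz
      · exact absurd hzW hy
      · obtain ⟨e, he, h⟩ := ih hy hz
        exact ⟨e, Multiset.mem_cons_of_mem he, h⟩

/-- A walk traverses a tree in depth-first order: each step either goes to a vertex that was not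
visited before, or back to the parent of the current vertex, and the walk ends at the root.
The first argument is the set of visited vertices, the second one the path from the current vertex
to the root. -/
def IsTreeWalk : Finset I → List I → List I → Prop
  | _, stk, [] => stk.length = 1
  | vis, stk, y :: t =>
    if y ∈ vis then stk.tail.head? = some y ∧ IsTreeWalk vis stk.tail t
    else IsTreeWalk (insert y vis) (y :: stk) t

lemma isTreeWalk_insert {v : I} {t : List I} (hv : v ∉ t) (vis : Finset I) (stk : List I) :
    IsTreeWalk (insert v vis) stk t ↔ IsTreeWalk vis stk t := by
  induction t generalizing vis stk with
  | nil => rfl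
  | cons y t ih =>
    rw [List.mem_cons, not_or] at hv
    have hy : y ∈ insert v vis ↔ y ∈ vis := by
      rw [Finset.mem_insert]
      exact or_iff_right (Ne.symm hv.1)
    rw [IsTreeWalk, IsTreeWalk]
    by_cases h : y ∈ vis
    · rw [if_pos h, if_pos (hy.mpr h), ih hv.2]
    · rw [if_neg h, if_neg (fun h' => h (hy.mp h')), Finset.insert_comm, ih hv.2]

/-- The detour pushes the fresh vertex `v` and pops it at once, restoring the stack. That `v` stays
marked as visited is harmless, because it does not recur. -/
lemma isTreeWalk_prune {v : I} {t s : List I} (hvt : v ∉ t) (hvs : v ∉ s) (vis : Finset I)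
    (x : I) (below : List I) (hv : v ∉ vis) (hstk : ∀ z ∈ x :: below, z ∈ vis) :
    IsTreeWalk vis (x :: below) (t ++ v :: t.getLastD x :: s) ↔
      IsTreeWalk vis (x :: below) (t ++ s) := by
  induction t generalizing vis x below with
  | nil =>
    have hx : x ∈ insert v vis := Finset.mem_insert_of_mem (hstk x (by simp))
    simp only [List.nil_append, List.getLastD_nil]
    rw [IsTreeWalk, if_neg hv, IsTreeWalk, if_pos hx]
    simp [isTreeWalk_insert hvs]
  | cons y t ih =>
    rw [List.mem_cons, not_or] at hvt
    rw [List.cons_append, List.cons_append, List.getLastD_cons, IsTreeWalk, IsTreeWalk]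
    by_cases h : y ∈ vis
    · rw [if_pos h, if_pos h, List.tail_cons]
      refine and_congr_right fun hb => ?_
      obtain ⟨b, rfl⟩ : ∃ b, below = y :: b := by
        cases below with
        | nil => simp at hb
        | cons z b => exact ⟨b, by simpa using hb⟩
      exact ih hvt.2 vis y b hv fun z hz => hstk z (List.mem_cons_of_mem _ hz)
    · rw [if_neg h, if_neg h]
      refine ih hvt.2 _ y (x :: below) ?_ ?_
      · rw [Finset.mem_insert, not_or]
        exact ⟨hvt.1, hv⟩
      · intro z hz
        rcases List.mem_cons.mp hz with rfl | hz
        · exact Finset.mem_insert_self _ _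
        · exact Finset.mem_insert_of_mem (hstk z hz)

/-- The stack has to shrink to a single entry, and popping the entry just above `v` is a step to
`v`, which no longer occurs. -/
lemma not_isTreeWalk_of_buried {v : I} {t : List I} (hv : v ∉ t) (vis : Finset I)
    (above : List I) (habove : above ≠ []) (b : I) (below : List I) :
    ¬ IsTreeWalk vis (above ++ v :: b :: below) t := by
  induction t generalizing vis above with
  | nil =>
    rw [IsTreeWalk]
    simp
    omega
  | cons y t ih =>
    rw [List.mem_cons, not_or] at hv
    rw [IsTreeWalk]
    obtain ⟨z, w, rfl⟩ := List.exists_cons_of_ne_nil habove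
    split_ifs with h
    · rintro ⟨h1, h2⟩
      cases w with
      | nil =>
        simp only [List.cons_append, List.nil_append, List.tail_cons, List.head?_cons,
          Option.some.injEq] at h1
        exact hv.1 h1
      | cons z' w' => exact ih hv.2 vis (z' :: w') (by simp) h2
    · exact ih hv.2 _ (y :: z :: w) (by simp)

/-- Once `v` lies on top of its predecessor, a step to any other vertex `c` cannot be a pop. It has
to push, and then `v` is buried. -/
lemma not_isTreeWalk_of_ne {v c : I} {t s : List I} (hvt : v ∉ t) (hvs : v ∉ c :: s)
    (vis : Finset I) (x : I) (below : List I) (hv : v ∉ vis) (hc : c ≠ t.getLastD x) :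
    ¬ IsTreeWalk vis (x :: below) (t ++ v :: c :: s) := by
  induction t generalizing vis x below with
  | nil =>
    rw [List.nil_append, IsTreeWalk, if_neg hv, IsTreeWalk]
    rw [List.mem_cons, not_or] at hvs
    split_ifs with h
    · rintro ⟨h1, -⟩
      simp only [List.tail_cons, List.head?_cons, Option.some.injEq] at h1
      exact hc h1.symm
    · exact not_isTreeWalk_of_buried hvs.2 _ [c] (by simp) x below
  | cons y t ih =>
    rw [List.mem_cons, not_or] at hvt
    rw [List.getLastD_cons] at hc
    rw [List.cons_append, IsTreeWalk]
    split_ifs with h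
    · rintro ⟨hb, h2⟩
      rw [List.tail_cons] at hb h2
      obtain ⟨b, rfl⟩ : ∃ b, below = y :: b := by
        cases below with
        | nil => simp at hb
        | cons z b => exact ⟨b, by simpa using hb⟩
      exact ih hvt.2 vis y b hv hc h2
    · refine ih hvt.2 _ y (x :: below) ?_ hc
      rw [Finset.mem_insert, not_or]
      exact ⟨hvt.1, hv⟩

/-- With nothing left to discover, every step is a pop. -/
lemma IsTreeWalk.mem_tail {vis : Finset I} {stk t : List I} (h : IsTreeWalk vis stk t)
    (ht : ∀ y ∈ t, y ∈ vis) : ∀ y ∈ t, y ∈ stk.tail := by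
  induction t generalizing stk with
  | nil => simp
  | cons y t ih =>
    rw [IsTreeWalk, if_pos (ht y (by simp))] at h
    intro z hz
    rcases List.mem_cons.mp hz with rfl | hz
    · exact List.mem_of_head? h.1
    · exact List.mem_of_mem_tail (ih h.2 (fun w hw => ht w (List.mem_cons_of_mem _ hw)) z hz)

/-- The vertex discovered last is a leaf: afterwards the walk only retreats through older entries of
the stack. -/
lemma IsTreeWalk.exists_count_eq_one {vis : Finset I} {stk t : List I} (h : IsTreeWalk vis stk t)
    (hstk : ∀ z ∈ stk, z ∈ vis) (ht : ∃ y ∈ t, y ∉ vis) :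
    ∃ v ∈ t, v ∉ vis ∧ t.count v = 1 := by
  induction t generalizing vis stk with
  | nil => simp at ht
  | cons y t ih =>
    rw [IsTreeWalk] at h
    split_ifs at h with hy
    · obtain ⟨z, hz, hzv⟩ := ht
      have hzt : z ∈ t := (List.mem_cons.mp hz).resolve_left (fun h => hzv (h ▸ hy))
      obtain ⟨v, hv, hvv, hc⟩ := ih h.2 (fun w hw => hstk w (List.mem_of_mem_tail hw))
        ⟨z, hzt, hzv⟩
      refine ⟨v, List.mem_cons_of_mem _ hv, hvv, ?_⟩
      rw [List.count_cons_of_ne (by rintro rfl; exact hvv hy), hc]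
    · by_cases hex : ∃ z ∈ t, z ∉ insert y vis
      · obtain ⟨v, hv, hvv, hc⟩ := ih h (by
          intro z hz
          rcases List.mem_cons.mp hz with rfl | hz
          · exact Finset.mem_insert_self _ _
          · exact Finset.mem_insert_of_mem (hstk z hz)) hex
        rw [Finset.mem_insert, not_or] at hvv
        refine ⟨v, List.mem_cons_of_mem _ hv, hvv.2, ?_⟩
        rw [List.count_cons_of_ne (Ne.symm hvv.1), hc]
      · push Not at hex
        have hyt : y ∉ t := fun hyt => hy (hstk y (h.mem_tail hex y hyt))
        exact ⟨y, by simp, hy, by rw [List.count_cons_self, List.count_eq_zero.mpr hyt]⟩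

lemma IsTreeWalk.exists_visited_once {x : I} {t : List I} (h : IsTreeWalk {x} [x] t)
    (ht : t ≠ []) : ∃ v ∈ t, v ≠ x ∧ t.count v = 1 := by
  obtain ⟨y, t', rfl⟩ := List.exists_cons_of_ne_nil ht
  have hy : y ∉ ({x} : Finset I) := by
    intro hy
    rw [IsTreeWalk, if_pos hy] at h
    simp at h
  obtain ⟨v, hv, hvx, hc⟩ := h.exists_count_eq_one (by simp) ⟨y, by simp, hy⟩
  exact ⟨v, hv, by simpa using hvx, hc⟩

open Classical in
/-- The indicator function of the closed walks that traverse a tree. -/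
noncomputable def treeInd (x : I) (t : List I) : ℝ := if IsTreeWalk {x} [x] t then 1 else 0

end Words

/-! ### Averages over pairs of closed walks. -/

section Pairs

variable {I : Type*} {D : Type*} [Fintype I] [DecidableEq I] [Fintype D] [DecidableEq D]

/-- A closed walk without loops. -/
structure IsClosedWord (x : I) (t : List I) : Prop where
  closed : t.getLastD x = x
  loopless : ∀ e ∈ chainEdges x t, e.1 ≠ e.2

variable {x y : I} {t s : List I}

lemma IsClosedWord.rootedFlow (ht : IsClosedWord x t) (hs : IsClosedWord y s) :
    RootedFlow {x, y} ((t ++ s).toFinset \ {x, y}) (chainEdges x t + chainEdges y s) where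
  disj := Finset.disjoint_sdiff
  loopless := by
    intro e he
    rcases Multiset.mem_add.mp he with he | he
    · exact ht.loopless e he
    · exact hs.loopless e he
  mem := by
    intro e he
    rcases Multiset.mem_add.mp he with he | he <;>
    · have h := mem_of_mem_chainEdges he
      simp only [Finset.union_sdiff_self_eq_union, Finset.mem_union, Finset.mem_insert,
        Finset.mem_singleton, List.mem_toFinset, List.mem_append, List.mem_cons] at h ⊢
      tauto
  balanced := by
    rw [Multiset.map_add, Multiset.map_add, chainEdges_balanced ht.closed,
      chainEdges_balanced hs.closed]
  cut := by
    rintro W hW ⟨z, hz⟩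
    have hx : x ∉ W := fun h => by simpa using hW h
    have hy : y ∉ W := fun h => by simpa using hW h
    have := hW hz
    simp only [Finset.mem_sdiff, List.mem_toFinset, List.mem_append] at this
    rcases this.1 with h | h
    · obtain ⟨e, he, h⟩ := chainEdges_cut hx h hz
      exact ⟨e, Multiset.mem_add.mpr (Or.inl he), h⟩
    · obtain ⟨e, he, h⟩ := chainEdges_cut hy h hz
      exact ⟨e, Multiset.mem_add.mpr (Or.inr he), h⟩

/-- A common vertex makes everything reachable from `x` alone, so `y` need not be a root. With one
root instead of two, the normalization of the product of moments leaves a spare factor `1 / n`. -/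
lemma IsClosedWord.rootedFlow_of_inter (ht : IsClosedWord x t) (hs : IsClosedWord y s) {z : I}
    (hz : z ∈ x :: t) (hz' : z ∈ y :: s) :
    RootedFlow {x} ((t ++ y :: s).toFinset \ {x}) (chainEdges x t + chainEdges y s) where
  disj := Finset.disjoint_sdiff
  loopless := by
    intro e he
    rcases Multiset.mem_add.mp he with he | he
    · exact ht.loopless e he
    · exact hs.loopless e he
  mem := by
    intro e he
    rcases Multiset.mem_add.mp he with he | he <;>
    · have h := mem_of_mem_chainEdges he
      simp only [Finset.union_sdiff_self_eq_union, Finset.mem_union,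
        Finset.mem_singleton, List.mem_toFinset, List.mem_append, List.mem_cons] at h ⊢
      tauto
  balanced := by
    rw [Multiset.map_add, Multiset.map_add, chainEdges_balanced ht.closed,
      chainEdges_balanced hs.closed]
  cut := by
    rintro W hW ⟨w, hw⟩
    have hx : x ∉ W := fun h => by simpa using hW h
    by_cases hex : ∃ w ∈ t, w ∈ W
    · obtain ⟨w, hwt, hwW⟩ := hex
      obtain ⟨e, he, h⟩ := chainEdges_cut hx hwt hwW
      exact ⟨e, Multiset.mem_add.mpr (Or.inl he), h⟩
    · push Not at hex
      have hzW : z ∉ W := by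
        rcases List.mem_cons.mp hz with rfl | hz
        · exact hx
        · exact hex z hz
      suffices h : ∃ e ∈ chainEdges y s, e.1 ∉ W ∧ e.2 ∈ W by
        obtain ⟨e, he, h⟩ := h
        exact ⟨e, Multiset.mem_add.mpr (Or.inr he), h⟩
      -- If `y ∈ W`, the closed walk `s` enters `W` between its visit to `z ∉ W` and its return to
      -- `y`.
      by_cases hy : y ∈ W
      · have hzs : z ∈ s := (List.mem_cons.mp hz').resolve_left (fun h => hzW (h ▸ hy))
        obtain ⟨s1, s2, rfl⟩ := List.append_of_mem hzs
        have hl := hs.closed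
        rw [getLastD_append', List.getLastD_cons] at hl
        have hys : y ∈ s2 := by
          have := getLastD_mem_cons s2 z
          rw [hl] at this
          exact (List.mem_cons.mp this).resolve_left (fun h => hzW (h ▸ hy))
        obtain ⟨e, he, h⟩ := chainEdges_cut hzW hys hy
        refine ⟨e, ?_, h⟩
        rw [chainEdges_append, chainEdges]
        exact Multiset.mem_add.mpr (Or.inr (Multiset.mem_cons_of_mem he))
      · have := hW hw
        simp only [Finset.mem_sdiff, List.mem_toFinset, List.mem_append, List.mem_cons] at this
        rcases this.1 with h | rfl | h
        · exact absurd hw (hex w h)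
        · exact absurd hw hy
        · exact chainEdges_cut hy h hw

/-- The scaled average over a pair of closed walks. -/
noncomputable def pairAvg (g : D → D → ℂ) (p : ℝ) (x : I) (t : List I) (y : I) (s : List I) : ℂ :=
  scaledAvg g p ((t ++ s).toFinset \ {x, y}) (chainEdges x t + chainEdges y s)

lemma pairAvg_comm (g : D → D → ℂ) (p : ℝ) (x : I) (t : List I) (y : I) (s : List I) :
    pairAvg g p x t y s = pairAvg g p y s x t := by
  unfold pairAvg
  rw [add_comm, Finset.pair_comm, List.toFinset_append, List.toFinset_append, Finset.union_comm]

variable {g : D → D → ℂ} {μ p X η : ℝ} {K : ℕ}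

/-- The vertex `v` is averaged out. If its two neighbours in the walk agree, it is pruned and the
tree indicator is unchanged. Otherwise the walk traverses no tree, and the whole average is an error
term. -/
lemma exists_shorter_word (hg : IsCoherentKernel g μ p X) (hμ : 0 ≤ μ)
    (hr : SparseRegime K (Fintype.card I) p X η) (ht : IsClosedWord x t) (hs : IsClosedWord y s)
    (hK : t.length + s.length + 2 ≤ K) {v : I} (hv : t.count v = 1)
    (hvx : v ≠ x) (hvs : v ∉ y :: s) :
    (‖pairAvg g p x t y s‖ ≤ (4 * K + 2) * η * flowBound μ K ∧ treeInd x t = 0) ∨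
    ∃ t' : List I, t'.length < t.length ∧ IsClosedWord x t' ∧ (∀ z ∈ t', z ∈ x :: t) ∧
      treeInd x t' = treeInd x t ∧
      ‖pairAvg g p x t y s - pairAvg g p x t' y s‖ ≤ (4 * K + 2) * η * flowBound μ K := by
  have hvt : v ∈ t := List.count_pos_iff.mp (by omega)
  obtain ⟨t1, t2, rfl⟩ := List.append_of_mem hvt
  rw [List.count_append, List.count_cons_self] at hv
  have hv1 : v ∉ t1 := List.count_eq_zero.mp (by omega)
  have hv2 : v ∉ t2 := List.count_eq_zero.mp (by omega)
  have hcl := ht.closed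
  rw [getLastD_append', List.getLastD_cons] at hcl
  obtain ⟨c, t3, rfl⟩ : ∃ c t3, t2 = c :: t3 := by
    cases t2 with
    | nil => exact absurd hcl hvx
    | cons c t3 => exact ⟨c, t3, rfl⟩
  rw [List.getLastD_cons] at hcl
  set a := t1.getLastD x with ha
  have hflow := ht.rootedFlow hs
  have hes : chainEdges x (t1 ++ v :: c :: t3) + chainEdges y s =
      (a, v) ::ₘ (v, c) ::ₘ (chainEdges x t1 + chainEdges c t3 + chainEdges y s) := by
    rw [chainEdges_append, chainEdges, chainEdges, ← ha]
    simp only [Multiset.add_cons, Multiset.cons_add]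
  have hcard := congrArg Multiset.card hes
  rw [Multiset.card_add, card_chainEdges, card_chainEdges] at hcard
  have hunt : ∀ e ∈ chainEdges x t1 + chainEdges c t3 + chainEdges y s, e.1 ≠ v ∧ e.2 ≠ v := by
    have hv3 : ∀ (z : I) (r : List I), v ∉ z :: r → ∀ e ∈ chainEdges z r, e.1 ≠ v ∧ e.2 ≠ v := by
      intro z r hzr e he
      have h := mem_of_mem_chainEdges he
      exact ⟨fun h' => hzr (h' ▸ h.1), fun h' => hzr (List.mem_cons_of_mem _ (h' ▸ h.2))⟩
    intro e he
    rcases Multiset.mem_add.mp he with he | he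
    · rcases Multiset.mem_add.mp he with he | he
      · exact hv3 _ _ (by simp [hvx, hv1]) e he
      · exact hv3 _ _ hv2 e he
    · exact hv3 _ _ hvs e he
  rw [List.mem_cons, not_or] at hvs
  set U := ((t1 ++ v :: c :: t3) ++ s).toFinset \ {x, y} with hU
  have hvU : v ∈ U := by
    rw [hU]
    simp [hvx, hvs.1]
  have hV : (({x, y} : Finset I) ∪ U).card ≤ K := by
    rw [hU, Finset.union_sdiff_self_eq_union]
    refine (Finset.card_union_le _ _).trans ?_
    have h1 := Finset.card_le_two (a := x) (b := y)
    have h2 := List.toFinset_card_le ((t1 ++ v :: c :: t3) ++ s)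
    rw [List.length_append] at h2
    omega
  have hflow' := hflow
  rw [hes] at hflow'
  have hbound := norm_scaledAvg_sub_le_flowBound hg hμ hr hflow' hvU hunt hV (by omega)
  rw [← hes] at hbound
  by_cases hac : a = c
  · right
    subst hac
    rw [if_pos rfl] at hbound
    have hch : chainEdges x (t1 ++ t3) = chainEdges x t1 + chainEdges a t3 := by
      rw [chainEdges_append]
    refine ⟨t1 ++ t3, by simp, ⟨?_, ?_⟩, ?_, ?_, ?_⟩
    · rw [getLastD_append', ← ha, hcl]
    · intro e he
      rw [hch] at he
      exact hflow.loopless e (by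
        rw [hes]
        simp only [Multiset.mem_cons, Multiset.mem_add] at he ⊢
        tauto)
    · intro z hz
      simp only [List.mem_append, List.mem_cons] at hz ⊢
      tauto
    · have hiff := isTreeWalk_prune hv1 (fun h => hv2 (List.mem_cons_of_mem _ h) : v ∉ t3) {x} x []
        (by simpa using hvx) (by simp)
      rw [← ha] at hiff
      by_cases h : IsTreeWalk {x} [x] (t1 ++ t3)
      · rw [treeInd, treeInd, if_pos h, if_pos (hiff.mpr h)]
      · rw [treeInd, treeInd, if_neg h, if_neg (fun h' => h (hiff.mp h'))]
    · unfold pairAvg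
      rw [hch]
      -- Pruning also deletes a visit to `a`, but `a` already occurs in `x :: t1`, so `v` is the
      -- only vertex lost.
      have hU' : U.erase v = (t1 ++ t3 ++ s).toFinset \ {x, y} := by
        have hmem : a ∈ x :: t1 := getLastD_mem_cons t1 x
        have hv3 : v ∉ t3 := fun h => hv2 (List.mem_cons_of_mem _ h)
        ext z
        simp only [hU, Finset.mem_erase, Finset.mem_sdiff, List.mem_toFinset, List.mem_append,
          List.mem_cons, Finset.mem_insert, Finset.mem_singleton] at hmem ⊢
        constructor
        · rintro ⟨h1, h2, h3⟩
          refine ⟨?_, h3⟩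
          rcases h2 with (h2 | h2 | rfl | h2) | h2
          · tauto
          · tauto
          · tauto
          · tauto
          · tauto
        · rintro ⟨h2, h3⟩
          refine ⟨?_, by tauto, h3⟩
          rintro rfl
          tauto
      rw [← hU']
      exact hbound
  · left
    rw [if_neg hac, sub_zero] at hbound
    refine ⟨hbound, ?_⟩
    unfold treeInd
    rw [if_neg (not_isTreeWalk_of_ne hv1 hv2 {x} x [] (by simpa using hvx) (Ne.symm hac))]

lemma embAvg_one (h : Fintype.card I ≤ Fintype.card D) : embAvg (fun _ : I ↪ D => (1 : ℂ)) = 1 := by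
  have : Nonempty (I ↪ D) := Function.Embedding.nonempty_of_card_le h
  have h0 : (Fintype.card (I ↪ D) : ℂ) ≠ 0 := by exact_mod_cast Fintype.card_ne_zero
  simp only [embAvg, Finset.sum_const, Finset.card_univ, nsmul_eq_mul, mul_one]
  exact inv_mul_cancel₀ h0

lemma SparseRegime.card_le (hg : IsCoherentKernel g μ p X)
    (hr : SparseRegime K (Fintype.card I) p X η) : Fintype.card I ≤ Fintype.card D := by
  have h1 : 1 ≤ X := by
    have := hr.inv_le.trans hr.le_one
    rwa [div_le_one hr.pos] at this
  have h2 : (Fintype.card I : ℝ) ≤ Fintype.card D := by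
    rw [hg.card]
    exact hr.le_dim.trans (le_mul_of_one_le_left (by linarith [hr.one_le, hr.le_dim]) h1)
  exact_mod_cast h2

lemma treeInd_nil (x : I) : treeInd x [] = 1 := by
  simp [treeInd, IsTreeWalk]

lemma treeInd_mem (x : I) (t : List I) : 0 ≤ treeInd x t ∧ treeInd x t ≤ 1 := by
  unfold treeInd
  split_ifs <;> simp

/-- Strong induction on the total length, with one error term per removed vertex. If no vertex other
than the base point of its walk is visited just once, either both walks are trivial and the average
is `1`, or the average is small by coherence. In the latter case the indicators multiply to zero,
since a nontrivial tree traversal has a leaf. -/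
theorem norm_pairAvg_sub_le (hg : IsCoherentKernel g μ p X) (hμ : 0 ≤ μ)
    (hr : SparseRegime K (Fintype.card I) p X η) (ht : IsClosedWord x t) (hs : IsClosedWord y s)
    (hts : ∀ z ∈ x :: t, z ∉ y :: s) (hK : t.length + s.length + 2 ≤ K) :
    ‖pairAvg g p x t y s - (treeInd x t * treeInd y s : ℝ)‖ ≤
      (t.length + s.length + 1 : ℕ) * ((4 * K + 2) * η * flowBound μ K) := by
  have hε : 0 ≤ (4 * K + 2) * η * flowBound μ K := by
    have := hr.eta_nonneg
    have := one_le_flowBound μ K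
    positivity
  induction hm : t.length + s.length using Nat.strong_induction_on generalizing x t y s with
  | _ m ih =>
    set ε := (4 * K + 2) * η * flowBound μ K with hεdef
    -- Stated for arbitrary words, so that `pairAvg_comm` also covers a removal from the second
    -- walk.
    have step : ∀ {x : I} {t : List I} {y : I} {s : List I}, IsClosedWord x t → IsClosedWord y s →
        (∀ z ∈ x :: t, z ∉ y :: s) → t.length + s.length = m → (∃ v, t.count v = 1 ∧ v ≠ x) →
        ‖pairAvg g p x t y s - (treeInd x t * treeInd y s : ℝ)‖ ≤ (m + 1 : ℕ) * ε := by
      rintro x t y s ht hs hts hm ⟨v, hv, hvx⟩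
      have hvt : v ∈ t := List.count_pos_iff.mp (by omega)
      rcases exists_shorter_word hg hμ hr ht hs (by omega) hv hvx
        (hts v (List.mem_cons_of_mem _ hvt)) with ⟨h1, h2⟩ | ⟨t', hlen, hcl, hsub, hind, hd⟩
      · rw [h2, zero_mul, Complex.ofReal_zero, sub_zero]
        refine h1.trans (le_mul_of_one_le_left hε ?_)
        push_cast
        linarith [(Nat.cast_nonneg m : (0 : ℝ) ≤ m)]
      · have h3 := ih (t'.length + s.length) (by omega) hcl hs (by
          intro z hz
          rcases List.mem_cons.mp hz with rfl | hz
          · exact hts z (by simp)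
          · exact hts z (hsub z hz)) (by omega) rfl
        rw [hind] at h3
        have h4 : ((t'.length + s.length + 1 : ℕ) : ℝ) * ε ≤ m * ε := by
          gcongr
          omega
        have h5 := norm_sub_le_norm_sub_add_norm_sub (pairAvg g p x t y s)
          (pairAvg g p x t' y s) ((treeInd x t * treeInd y s : ℝ) : ℂ)
        push_cast at *
        linarith
    by_cases h1 : ∃ v, t.count v = 1 ∧ v ≠ x
    · exact step ht hs hts hm h1
    by_cases h2 : ∃ v, s.count v = 1 ∧ v ≠ y
    · rw [pairAvg_comm, mul_comm (treeInd x t)]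
      exact step hs ht (fun z hz hz' => hts z hz' hz) (by omega) h2
    by_cases hnil : t = [] ∧ s = []
    · obtain ⟨rfl, rfl⟩ := hnil
      have h3 : pairAvg g p x [] y [] = 1 := by
        have h4 : edgeProd (I := I) g 0 = fun _ => 1 := by
          ext S
          simp [edgeProd]
        simp [pairAvg, scaledAvg, chainEdges, h4, embAvg_one (hr.card_le hg)]
      rw [h3, treeInd_nil, treeInd_nil]
      simp only [mul_one, Complex.ofReal_one, sub_self, norm_zero]
      positivity
    · have h0 : treeInd x t * treeInd y s = 0 := by
        rw [mul_eq_zero]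
        by_contra hcon
        push Not at hcon
        obtain ⟨ht1, hs1⟩ := hcon
        unfold treeInd at ht1 hs1
        simp only [ne_eq, ite_eq_right_iff, one_ne_zero, imp_false, not_not] at ht1 hs1
        by_cases htn : t = []
        · obtain ⟨v, -, hv, hv'⟩ := hs1.exists_visited_once (fun h => hnil ⟨htn, h⟩)
          exact h2 ⟨v, hv', hv⟩
        · obtain ⟨v, -, hv, hv'⟩ := ht1.exists_visited_once htn
          exact h1 ⟨v, hv', hv⟩
      rw [h0, Complex.ofReal_zero, sub_zero]
      have hne : chainEdges x t + chainEdges y s ≠ 0 := by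
        intro h
        have := congrArg Multiset.card h
        rw [Multiset.card_add, card_chainEdges, card_chainEdges, Multiset.card_zero] at this
        exact hnil ⟨List.length_eq_zero_iff.mp (by omega), List.length_eq_zero_iff.mp (by omega)⟩
      have h3 := norm_scaledAvg_le_of_two_le_count hg hμ hr (ht.rootedFlow hs)
        (by rw [Multiset.card_add, card_chainEdges, card_chainEdges]; omega) hne (by
          intro v hv
          rw [Multiset.map_add, map_snd_chainEdges, map_snd_chainEdges, Multiset.count_add,
            Multiset.coe_count, Multiset.coe_count]
          simp only [Finset.mem_sdiff, List.mem_toFinset, List.mem_append, Finset.mem_insert,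
            Finset.mem_singleton, not_or] at hv
          push Not at h1 h2
          have e1 : t.count v ≠ 1 := fun h => hv.2.1 (h1 v h)
          have e2 : s.count v ≠ 1 := fun h => hv.2.2 (h2 v h)
          rcases hv.1 with h | h <;> have := List.count_pos_iff.mpr h <;> omega)
      refine h3.trans (le_mul_of_one_le_left hε ?_)
      push_cast
      linarith [(Nat.cast_nonneg m : (0 : ℝ) ≤ m)]

end Pairs

/-! ### Weighted counting of walks, tree traversals and Dyck paths. -/

section Counting

variable {I : Type*} [Fintype I] [DecidableEq I]

lemma sum_ofFn_succ {M : Type*} [AddCommMonoid M] (k : ℕ) (φ : List I → M) :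
    ∑ f : Fin (k + 1) → I, φ (List.ofFn f) = ∑ y, ∑ f : Fin k → I, φ (y :: List.ofFn f) := by
  rw [← Fintype.sum_prod_type' (f := fun y (f : Fin k → I) => φ (y :: List.ofFn f))]
  refine (Fintype.sum_equiv (Fin.consEquiv fun _ => I) _ _ fun yf => ?_).symm
  rw [List.ofFn_succ]
  simp [Fin.consEquiv]

lemma card_cons_sdiff_of_mem {y : I} {vis : Finset I} (hy : y ∈ vis) (t : List I) :
    ((y :: t).toFinset \ vis).card = (t.toFinset \ vis).card := by
  rw [List.toFinset_cons, Finset.insert_sdiff_of_mem _ hy]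

lemma card_cons_sdiff_of_notMem {y : I} {vis : Finset I} (hy : y ∉ vis) (t : List I) :
    ((y :: t).toFinset \ vis).card = (t.toFinset \ insert y vis).card + 1 := by
  have : (y :: t).toFinset \ vis = insert y (t.toFinset \ insert y vis) := by
    ext z
    by_cases hz : z = y
    · subst hz
      simp [hy]
    · simp [hz]
  rw [this, Finset.card_insert_of_notMem (by simp)]

/-- The first letter is either already visited, of weight one, or new, of weight `1 / n`. The value
`0` of the `match` on the empty list is never attained. -/
lemma sum_split_visited (k : ℕ) (vis : Finset I) (φ : I → List I → ℝ) :
    ∑ f : Fin (k + 1) → I, ((Fintype.card I : ℝ)⁻¹) ^ ((List.ofFn f).toFinset \ vis).card *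
        (match List.ofFn f with | [] => 0 | y :: t => φ y t) =
      ∑ y ∈ vis, ∑ f : Fin k → I,
          ((Fintype.card I : ℝ)⁻¹) ^ ((List.ofFn f).toFinset \ vis).card * φ y (List.ofFn f) +
        ∑ y ∈ visᶜ, (Fintype.card I : ℝ)⁻¹ * ∑ f : Fin k → I,
          ((Fintype.card I : ℝ)⁻¹) ^ ((List.ofFn f).toFinset \ insert y vis).card *
            φ y (List.ofFn f) := by
  rw [sum_ofFn_succ k (fun t => ((Fintype.card I : ℝ)⁻¹) ^ (t.toFinset \ vis).card *
        (match t with | [] => 0 | y :: t => φ y t)), ← Finset.sum_add_sum_compl vis]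
  congr 1
  · refine Finset.sum_congr rfl fun y hy => Finset.sum_congr rfl fun f _ => ?_
    rw [card_cons_sdiff_of_mem hy]
  · refine Finset.sum_congr rfl fun y hy => ?_
    rw [Finset.mem_compl] at hy
    rw [Finset.mul_sum]
    refine Finset.sum_congr rfl fun f _ => ?_
    rw [card_cons_sdiff_of_notMem hy, pow_succ]
    ring

/-- At each step the old letters number at most `|vis| + k`, and the new ones have total weight at
most one. The bound is therefore independent of `|I|`. -/
lemma sum_pow_card_sdiff_le [Nonempty I] (k : ℕ) (vis : Finset I) :
    ∑ f : Fin k → I, ((Fintype.card I : ℝ)⁻¹) ^ ((List.ofFn f).toFinset \ vis).card ≤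
      ((vis.card : ℝ) + k) ^ k := by
  have hn : (0 : ℝ) < Fintype.card I := by exact_mod_cast Fintype.card_pos
  induction k generalizing vis with
  | zero => simp
  | succ k ih =>
    have h := sum_split_visited k vis (fun _ _ => 1)
    have h0 : ∀ f : Fin (k + 1) → I, (match List.ofFn f with | [] => (0 : ℝ) | _ :: _ => 1) = 1 := by
      intro f
      rw [List.ofFn_succ]
    simp only [h0, mul_one] at h
    rw [h]
    set b : ℝ := (vis.card : ℝ) + (k + 1 : ℕ) with hb
    have hb0 : 0 ≤ b := by positivity
    have h1 : ∑ y ∈ vis, ∑ f : Fin k → I,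
        ((Fintype.card I : ℝ)⁻¹) ^ ((List.ofFn f).toFinset \ vis).card ≤ vis.card * b ^ k := by
      rw [← nsmul_eq_mul, ← Finset.sum_const]
      refine Finset.sum_le_sum fun y _ => (ih vis).trans ?_
      refine pow_le_pow_left₀ (by positivity) ?_ _
      rw [hb]; push_cast; linarith
    have h2 : ∑ y ∈ visᶜ, (Fintype.card I : ℝ)⁻¹ * ∑ f : Fin k → I,
        ((Fintype.card I : ℝ)⁻¹) ^ ((List.ofFn f).toFinset \ insert y vis).card ≤ b ^ k := by
      calc _ ≤ ∑ y ∈ visᶜ, (Fintype.card I : ℝ)⁻¹ * b ^ k := by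
            refine Finset.sum_le_sum fun y hy => ?_
            refine mul_le_mul_of_nonneg_left ((ih _).trans ?_) (by positivity)
            refine pow_le_pow_left₀ (by positivity) ?_ _
            rw [Finset.card_insert_of_notMem (Finset.mem_compl.mp hy), hb]
            push_cast; linarith
        _ ≤ ∑ y : I, (Fintype.card I : ℝ)⁻¹ * b ^ k :=
            Finset.sum_le_sum_of_subset_of_nonneg (Finset.subset_univ _)
              fun _ _ _ => by positivity
        _ = b ^ k := by
            rw [Finset.sum_const, Finset.card_univ, nsmul_eq_mul]
            field_simp
    calc _ ≤ vis.card * b ^ k + b ^ k := add_le_add h1 h2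
      _ = (vis.card + 1) * b ^ k := by ring
      _ ≤ b * b ^ k := by
        gcongr
        rw [hb]; push_cast; linarith [(Nat.cast_nonneg k : (0 : ℝ) ≤ k)]
      _ = b ^ (k + 1) := by ring

/-- The number of nonnegative lattice paths with `k` steps `±1` from height `h` to height `0`. -/
def dyck : ℕ → ℕ → ℕ
  | 0, 0 => 1
  | 0, _ + 1 => 0
  | k + 1, 0 => dyck k 1
  | k + 1, h + 1 => dyck k (h + 2) + dyck k h

lemma dyck_le (k h : ℕ) : dyck k h ≤ 2 ^ k := by
  induction k generalizing h with
  | zero => cases h <;> simp [dyck]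
  | succ k ih =>
    cases h with
    | zero => rw [dyck, pow_succ]; have := ih 1; omega
    | succ h => rw [dyck, pow_succ]; have := ih (h + 2); have := ih h; omega

open Classical in
/-- The weighted number of ways to complete a walk to a closed walk that traverses a tree. -/
noncomputable def treeWeight (k : ℕ) (vis : Finset I) (stk : List I) : ℝ :=
  ∑ f : Fin k → I, ((Fintype.card I : ℝ)⁻¹) ^ ((List.ofFn f).toFinset \ vis).card *
    if IsTreeWalk vis stk (List.ofFn f) then 1 else 0

/-- A step to a visited vertex must be the step to the parent, which does not exist at the root. -/
lemma treeWeight_succ (k : ℕ) (vis : Finset I) (x : I) (below : List I)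
    (hb : ∀ z ∈ below, z ∈ vis) :
    treeWeight (k + 1) vis (x :: below) =
      (if below = [] then 0 else treeWeight k vis below) +
        ∑ y ∈ visᶜ, (Fintype.card I : ℝ)⁻¹ * treeWeight k (insert y vis) (y :: x :: below) := by
  classical
  have h := sum_split_visited k vis
    (fun y t => if IsTreeWalk vis (x :: below) (y :: t) then 1 else 0)
  have h0 : treeWeight (k + 1) vis (x :: below) = ∑ f : Fin (k + 1) → I,
      ((Fintype.card I : ℝ)⁻¹) ^ ((List.ofFn f).toFinset \ vis).card *
        (match List.ofFn f with
          | [] => 0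
          | y :: t => if IsTreeWalk vis (x :: below) (y :: t) then 1 else 0) := by
    unfold treeWeight
    refine Finset.sum_congr rfl fun f _ => ?_
    rw [List.ofFn_succ]
  rw [h0, h]
  congr 1
  · cases below with
    | nil =>
      rw [if_pos rfl]
      refine Finset.sum_eq_zero fun y hy => Finset.sum_eq_zero fun f _ => ?_
      rw [IsTreeWalk, if_pos hy]
      simp
    | cons z b =>
      rw [if_neg (by simp), Finset.sum_eq_single z]
      · refine Finset.sum_congr rfl fun f _ => ?_
        rw [IsTreeWalk, if_pos (hb z (by simp))]
        simp
      · intro y hy hyz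
        refine Finset.sum_eq_zero fun f _ => ?_
        rw [IsTreeWalk, if_pos hy]
        simp [Ne.symm hyz]
      · intro hz
        exact absurd (hb z (by simp)) hz
  · refine Finset.sum_congr rfl fun y hy => ?_
    congr 1
    refine Finset.sum_congr rfl fun f _ => ?_
    rw [IsTreeWalk, if_neg (Finset.mem_compl.mp hy)]

/-- Pushes and pops are the up and down steps of a lattice path at height `|below|`. The only error
is that the fresh vertices have total weight `1 - |vis| / n` instead of `1`. -/
lemma abs_treeWeight_sub_le [Nonempty I] (K k : ℕ) (vis : Finset I) (x : I) (below : List I)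
    (hb : ∀ z ∈ x :: below, z ∈ vis) (hK : vis.card + k ≤ K) :
    |treeWeight k vis (x :: below) - dyck k below.length| ≤
      k * 2 ^ k * K * (Fintype.card I : ℝ)⁻¹ := by
  have hn : (0 : ℝ) < Fintype.card I := by exact_mod_cast Fintype.card_pos
  set q : ℝ := (Fintype.card I : ℝ)⁻¹ with hq
  have hq0 : 0 < q := inv_pos.mpr hn
  induction k generalizing vis x below with
  | zero =>
    have : treeWeight 0 vis (x :: below) = dyck 0 below.length := by
      cases below <;> simp [treeWeight, IsTreeWalk, dyck]
    simp [this]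
  | succ k ih =>
    rw [treeWeight_succ k vis x below fun z hz => hb z (List.mem_cons_of_mem _ hz)]
    set e : ℝ := k * 2 ^ k * K * q with he
    have he0 : 0 ≤ e := by positivity
    set d : ℝ := ((dyck k (below.length + 1) : ℕ) : ℝ) with hd
    have hd2 : d ≤ 2 ^ k := by rw [hd]; exact_mod_cast dyck_le _ _
    have hd0 : 0 ≤ d := by positivity
    have h1 : |(if below = [] then 0 else treeWeight k vis below) -
        (dyck (k + 1) below.length - d)| ≤ e := by
      cases below with
      | nil => simpa [dyck, hd] using he0
      | cons z b =>
        have := ih vis z b (fun w hw => hb w (List.mem_cons_of_mem _ hw)) (by omega)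
        rw [if_neg (by simp), hd]
        simpa [dyck] using this
    have h2 : |∑ y ∈ visᶜ, q * treeWeight k (insert y vis) (y :: x :: below) - d| ≤
        e + K * q * 2 ^ k := by
      have h3 : ∑ y ∈ visᶜ, q * treeWeight k (insert y vis) (y :: x :: below) - d =
          ∑ y ∈ visᶜ, q * (treeWeight k (insert y vis) (y :: x :: below) - d) -
            vis.card * q * d := by
        simp only [mul_sub, Finset.sum_sub_distrib, Finset.sum_const, nsmul_eq_mul]
        rw [Finset.card_compl, Nat.cast_sub (Finset.card_le_univ _)]
        have : (Fintype.card I : ℝ) * q = 1 := mul_inv_cancel₀ hn.ne'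
        linear_combination d * this
      rw [h3]
      refine (abs_sub _ _).trans (add_le_add ?_ ?_)
      · refine (Finset.abs_sum_le_sum_abs _ _).trans ?_
        calc _ ≤ ∑ y ∈ visᶜ, q * e := by
              refine Finset.sum_le_sum fun y hy => ?_
              rw [abs_mul, abs_of_pos hq0]
              refine mul_le_mul_of_nonneg_left ?_ hq0.le
              refine ih (insert y vis) y (x :: below) ?_ ?_
              · intro z hz
                rcases List.mem_cons.mp hz with rfl | hz
                · exact Finset.mem_insert_self _ _
                · exact Finset.mem_insert_of_mem (hb z hz)
              · rw [Finset.card_insert_of_notMem (Finset.mem_compl.mp hy)]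
                omega
          _ ≤ ∑ y : I, q * e :=
              Finset.sum_le_sum_of_subset_of_nonneg (Finset.subset_univ _)
                fun _ _ _ => by positivity
          _ = e := by
              rw [Finset.sum_const, Finset.card_univ, nsmul_eq_mul, hq]
              field_simp
      · rw [abs_of_nonneg (by positivity)]
        have : (vis.card : ℝ) ≤ K := by exact_mod_cast (by omega : vis.card ≤ K)
        gcongr
    have h4 := abs_add_le ((if below = [] then 0 else treeWeight k vis below) -
        (dyck (k + 1) below.length - d))
        (∑ y ∈ visᶜ, q * treeWeight k (insert y vis) (y :: x :: below) - d)
    -- The error at most doubles and gains `K q 2 ^ k` in each step, which explains the form `k 2 ^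
    -- k K q`.
    have h5 : ((k + 1 : ℕ) : ℝ) * 2 ^ (k + 1) * K * q = 2 * e + 2 * (K * q * 2 ^ k) := by
      rw [he]; push_cast; ring
    have h6 : 0 ≤ K * q * 2 ^ k := by positivity
    rw [h5]
    refine le_trans (le_of_eq ?_) (h4.trans (by linarith))
    congr 1
    ring

/-- The weighted number of closed walks with `k` steps that traverse a tree. -/
noncomputable def treeCount (I : Type*) [Fintype I] [DecidableEq I] (k : ℕ) : ℝ :=
  ∑ x : I, ∑ f : Fin k → I,
    ((Fintype.card I : ℝ)⁻¹) ^ (x :: List.ofFn f).toFinset.card * treeInd x (List.ofFn f)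

lemma abs_treeCount_sub_le [Nonempty I] (k : ℕ) :
    |treeCount I k - dyck k 0| ≤ k * 2 ^ k * (k + 1) * (Fintype.card I : ℝ)⁻¹ := by
  have hn : (0 : ℝ) < Fintype.card I := by exact_mod_cast Fintype.card_pos
  have h1 : treeCount I k = ∑ x : I, (Fintype.card I : ℝ)⁻¹ * treeWeight k {x} [x] := by
    refine Finset.sum_congr rfl fun x _ => ?_
    rw [treeWeight, Finset.mul_sum]
    refine Finset.sum_congr rfl fun f _ => ?_
    have h := card_cons_sdiff_of_notMem (Finset.notMem_empty x) (List.ofFn f)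
    rw [Finset.sdiff_empty, insert_empty_eq] at h
    rw [h, pow_succ, treeInd]
    ring
  have h2 : treeCount I k - dyck k 0 =
      ∑ x : I, (Fintype.card I : ℝ)⁻¹ * (treeWeight k {x} [x] - dyck k 0) := by
    simp only [h1, mul_sub, Finset.sum_sub_distrib, Finset.sum_const, Finset.card_univ,
      nsmul_eq_mul]
    field_simp
  rw [h2]
  refine (Finset.abs_sum_le_sum_abs _ _).trans ?_
  calc _ ≤ ∑ _x : I, (Fintype.card I : ℝ)⁻¹ *
        (k * 2 ^ k * (k + 1 : ℕ) * (Fintype.card I : ℝ)⁻¹) := by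
        refine Finset.sum_le_sum fun x _ => ?_
        rw [abs_mul, abs_of_pos (inv_pos.mpr hn)]
        refine mul_le_mul_of_nonneg_left ?_ (inv_pos.mpr hn).le
        exact abs_treeWeight_sub_le (k + 1) k {x} x [] (by simp) (by simp; omega)
    _ = _ := by
        rw [Finset.sum_const, Finset.card_univ, nsmul_eq_mul]
        push_cast
        field_simp

lemma IsTreeWalk.getLastD_eq {vis : Finset I} {x : I} {below t : List I}
    (h : IsTreeWalk vis (x :: below) t) : t.getLastD x = below.getLastD x := by
  induction t generalizing vis x below with
  | nil =>
    rw [IsTreeWalk, List.length_cons, Nat.add_eq_right, List.length_eq_zero_iff] at h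
    rw [h]
  | cons y t ih =>
    rw [IsTreeWalk] at h
    rw [List.getLastD_cons]
    split_ifs at h
    · cases below with
      | nil => simp at h
      | cons z b =>
        obtain ⟨h1, h2⟩ := h
        obtain rfl : z = y := by simpa using h1
        rw [ih h2, List.getLastD_cons]
    · rw [ih h, List.getLastD_cons]

lemma IsTreeWalk.loopless {vis : Finset I} {x : I} {below t : List I}
    (h : IsTreeWalk vis (x :: below) t) (hstk : ∀ z ∈ x :: below, z ∈ vis)
    (hnd : (x :: below).Nodup) : ∀ e ∈ chainEdges x t, e.1 ≠ e.2 := by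
  induction t generalizing vis x below with
  | nil => simp [chainEdges]
  | cons y t ih =>
    rw [IsTreeWalk] at h
    intro e he
    rw [chainEdges, Multiset.mem_cons] at he
    split_ifs at h with hy
    · cases below with
      | nil => simp at h
      | cons z b =>
        obtain ⟨h1, h2⟩ := h
        obtain rfl : z = y := by simpa using h1
        rcases he with rfl | he
        · intro hxz
          simp only at hxz
          subst hxz
          simp at hnd
        · exact ih h2 (fun w hw => hstk w (List.mem_cons_of_mem _ hw))
            (List.nodup_cons.mp hnd).2 e he
    · rcases he with rfl | he
      · intro hxy
        have hxy : x = y := hxy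
        exact hy (hxy ▸ hstk x (by simp))
      · refine ih h ?_ ?_ e he
        · intro z hz
          rcases List.mem_cons.mp hz with rfl | hz
          · exact Finset.mem_insert_self _ _
          · exact Finset.mem_insert_of_mem (hstk z hz)
        · exact List.nodup_cons.mpr ⟨fun h => hy (hstk y h), hnd⟩

lemma isClosedWord_of_treeInd_ne_zero {x : I} {t : List I} (h : treeInd x t ≠ 0) :
    IsClosedWord x t := by
  have h' : IsTreeWalk {x} [x] t := by
    by_contra hc
    exact h (if_neg hc)
  exact ⟨by simpa using h'.getLastD_eq, h'.loopless (by simp) (by simp)⟩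

end Counting

/-! ### Mean of a product of two spectral moments. -/

section Moments

variable {I : Type*} {D : Type*} [Fintype I] [DecidableEq I] [Fintype D] [DecidableEq D]

lemma matrix_pow_apply_eq_sum (M : Matrix I I ℂ) (k : ℕ) (x z : I) :
    (M ^ k) x z = ∑ f : Fin k → I, if (List.ofFn f).getLastD x = z then
      ((chainEdges x (List.ofFn f)).map fun e => M e.1 e.2).prod else 0 := by
  induction k generalizing x with
  | zero => simp [chainEdges, Matrix.one_apply]
  | succ k ih =>
    rw [pow_succ', Matrix.mul_apply, sum_ofFn_succ k (fun t => if t.getLastD x = z then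
      ((chainEdges x t).map fun e => M e.1 e.2).prod else 0)]
    refine Finset.sum_congr rfl fun y _ => ?_
    rw [ih, Finset.mul_sum]
    refine Finset.sum_congr rfl fun f _ => ?_
    rw [List.getLastD_cons, chainEdges, Multiset.map_cons, Multiset.prod_cons, mul_ite, mul_zero]

/-- The normalized off-diagonal part of the Gram matrix of a sample. -/
noncomputable def kernelMatrix (g : D → D → ℂ) (p : ℝ) (S : I ↪ D) : Matrix I I ℂ :=
  Matrix.of fun i j => if i = j then 0 else (√(p / Fintype.card I) : ℝ) * g (S i) (S j)

lemma prod_kernelMatrix (g : D → D → ℂ) (p : ℝ) (S : I ↪ D) (es : Multiset (I × I))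
    [Decidable (∀ e ∈ es, e.1 ≠ e.2)] :
    (es.map fun e => kernelMatrix g p S e.1 e.2).prod =
      if ∀ e ∈ es, e.1 ≠ e.2 then
        ((√(p / Fintype.card I) : ℝ) : ℂ) ^ es.card * edgeProd g es S else 0 := by
  split_ifs with h
  · rw [edgeProd, ← Multiset.card_map (fun e : I × I => g (S e.1) (S e.2)) es,
      ← Multiset.prod_replicate, ← Multiset.map_const', Multiset.map_map,
      ← Multiset.prod_map_mul]
    congr 1
    refine Multiset.map_congr rfl fun e he => ?_
    simp [kernelMatrix, h e he]
  · push Not at h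
    obtain ⟨e, he, heq⟩ := h
    refine Multiset.prod_eq_zero (Multiset.mem_map.mpr ⟨e, he, ?_⟩)
    simp [kernelMatrix, heq]

/-- The `k`-th moment of the spectral distribution of the off-diagonal part. -/
noncomputable def kernelMoment (g : D → D → ℂ) (p : ℝ) (k : ℕ) (S : I ↪ D) : ℂ :=
  (Fintype.card I : ℂ)⁻¹ * (kernelMatrix g p S ^ k).trace

open Classical in
lemma kernelMoment_eq_sum (g : D → D → ℂ) (p : ℝ) (k : ℕ) (S : I ↪ D) :
    kernelMoment g p k S = ∑ x : I, ∑ f : Fin k → I, if IsClosedWord x (List.ofFn f) then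
      (Fintype.card I : ℂ)⁻¹ * (((√(p / Fintype.card I) : ℝ) : ℂ) ^ k *
        edgeProd g (chainEdges x (List.ofFn f)) S) else 0 := by
  rw [kernelMoment, Matrix.trace, Finset.mul_sum]
  refine Finset.sum_congr rfl fun x _ => ?_
  rw [Matrix.diag_apply, matrix_pow_apply_eq_sum, Finset.mul_sum]
  refine Finset.sum_congr rfl fun f _ => ?_
  rw [prod_kernelMatrix, card_chainEdges, List.length_ofFn]
  by_cases h1 : (List.ofFn f).getLastD x = x
  · by_cases h2 : ∀ e ∈ chainEdges x (List.ofFn f), e.1 ≠ e.2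
    · rw [if_pos h1, if_pos h2, if_pos ⟨h1, h2⟩]
    · rw [if_pos h1, if_neg h2, if_neg fun h => h2 h.loopless, mul_zero]
  · rw [if_neg h1, if_neg fun h => h1 h.closed, mul_zero]

lemma edgeProd_add (g : D → D → ℂ) (es fs : Multiset (I × I)) (S : I ↪ D) :
    edgeProd g (es + fs) S = edgeProd g es S * edgeProd g fs S := by
  simp [edgeProd]

lemma embAvg_sum {ι : Type*} (s : Finset ι) (φ : ι → (I ↪ D) → ℂ) :
    embAvg (fun S => ∑ i ∈ s, φ i S) = ∑ i ∈ s, embAvg (φ i) := by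
  simp only [embAvg]
  rw [Finset.sum_comm, Finset.mul_sum]

lemma embAvg_const_mul (c : ℂ) (φ : (I ↪ D) → ℂ) :
    embAvg (fun S => c * φ S) = c * embAvg φ := by
  simp only [embAvg, ← Finset.mul_sum]
  ring

open Classical in
/-- The contribution of a pair of closed walks to the product of two moments. -/
noncomputable def pairTerm (g : D → D → ℂ) (p : ℝ) (x : I) (t : List I) (y : I) (s : List I) : ℂ :=
  if IsClosedWord x t ∧ IsClosedWord y s then
    (Fintype.card I : ℂ)⁻¹ ^ 2 * (((√(p / Fintype.card I) : ℝ) : ℂ) ^ (t.length + s.length) *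
      embAvg (edgeProd g (chainEdges x t + chainEdges y s))) else 0

lemma embAvg_kernelMoment_mul (g : D → D → ℂ) (p : ℝ) (k l : ℕ) :
    embAvg (fun S : I ↪ D => kernelMoment g p k S * kernelMoment g p l S) =
      ∑ x : I, ∑ f : Fin k → I, ∑ y : I, ∑ h : Fin l → I,
        pairTerm g p x (List.ofFn f) y (List.ofFn h) := by
  classical
  have h : ∀ S : I ↪ D, kernelMoment g p k S * kernelMoment g p l S =
      ∑ x : I, ∑ f : Fin k → I, ∑ y : I, ∑ h : Fin l → I,
        (if IsClosedWord x (List.ofFn f) ∧ IsClosedWord y (List.ofFn h) then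
          (Fintype.card I : ℂ)⁻¹ ^ 2 * ((√(p / Fintype.card I) : ℝ) : ℂ) ^ (k + l) else 0) *
          edgeProd g (chainEdges x (List.ofFn f) + chainEdges y (List.ofFn h)) S := by
    intro S
    rw [kernelMoment_eq_sum, kernelMoment_eq_sum, Finset.sum_mul]
    refine Finset.sum_congr rfl fun x _ => ?_
    rw [Finset.sum_mul]
    refine Finset.sum_congr rfl fun f _ => ?_
    rw [Finset.mul_sum]
    refine Finset.sum_congr rfl fun y _ => ?_
    rw [Finset.mul_sum]
    refine Finset.sum_congr rfl fun h _ => ?_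
    rw [edgeProd_add]
    by_cases h1 : IsClosedWord x (List.ofFn f) <;> by_cases h2 : IsClosedWord y (List.ofFn h)
    · rw [if_pos h1, if_pos h2, if_pos ⟨h1, h2⟩]
      ring
    all_goals simp [h1, h2]
  simp only [h, embAvg_sum, embAvg_const_mul]
  simp only [pairTerm, List.length_ofFn, ite_mul, zero_mul,
    mul_assoc]

variable {g : D → D → ℂ} {μ p X η : ℝ}

/-- Let `r` be the number of vertices of the union. For disjoint closed walks the difference is `n ^
(-r)` times the one in `norm_pairAvg_sub_le`. For closed walks that meet, each of the two terms is
separately `O(n ^ (-r - 1))`, and `1 / n ≤ η`. -/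
lemma norm_pairTerm_sub_le (hg : IsCoherentKernel g μ p X) (hμ : 0 ≤ μ) {K : ℕ}
    (hr : SparseRegime K (Fintype.card I) p X η) (x : I) (t : List I) (y : I) (s : List I)
    (hK : t.length + s.length + 2 ≤ K) :
    ‖pairTerm g p x t y s - (((Fintype.card I : ℝ)⁻¹ ^ (x :: t).toFinset.card * treeInd x t) *
      ((Fintype.card I : ℝ)⁻¹ ^ (y :: s).toFinset.card * treeInd y s) : ℝ)‖ ≤
      (Fintype.card I : ℝ)⁻¹ ^ ((x :: t).toFinset ∪ (y :: s).toFinset).card *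
        (η * (K * (4 * K + 2) * flowBound μ K + flowBound μ K + 1)) := by
  classical
  set n : ℝ := ((Fintype.card I : ℕ) : ℝ) with hn
  have hn1 : 1 ≤ n := hr.one_le
  have hn0 : 0 < n := by linarith
  have hη := hr.eta_nonneg
  have hB := one_le_flowBound μ K
  have hB0 : 0 ≤ flowBound μ K := by linarith
  set r := ((x :: t).toFinset ∪ (y :: s).toFinset).card with hrdef
  have hnC : (Fintype.card I : ℂ) = (n : ℂ) := by rw [hn]; norm_cast
  by_cases hcl : IsClosedWord x t ∧ IsClosedWord y s
  swap
  · have h0 : treeInd x t = 0 ∨ treeInd y s = 0 := by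
      by_contra hcon
      push Not at hcon
      exact hcl ⟨isClosedWord_of_treeInd_ne_zero hcon.1, isClosedWord_of_treeInd_ne_zero hcon.2⟩
    have h1 : (n⁻¹ ^ (x :: t).toFinset.card * treeInd x t) *
      (n⁻¹ ^ (y :: s).toFinset.card * treeInd y s) = 0 := by
      rcases h0 with h0 | h0 <;> rw [h0] <;> ring
    rw [pairTerm, if_neg hcl, h1, Complex.ofReal_zero, sub_zero, norm_zero]
    positivity
  obtain ⟨ht, hs⟩ := hcl
  have hpt : pairTerm g p x t y s = (n : ℂ)⁻¹ ^ 2 * (((√(p / n) : ℝ) : ℂ) ^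
      (t.length + s.length) * embAvg (edgeProd g (chainEdges x t + chainEdges y s))) := by
    rw [pairTerm, if_pos ⟨ht, hs⟩, hnC]
  have hsc : ∀ U : Finset I, (n : ℂ)⁻¹ ^ U.card *
      scaledAvg g p U (chainEdges x t + chainEdges y s) = ((√(p / n) : ℝ) : ℂ) ^
      (t.length + s.length) * embAvg (edgeProd g (chainEdges x t + chainEdges y s)) := by
    intro U
    rw [scaledAvg, Multiset.card_add, card_chainEdges, card_chainEdges, ← hn]
    push_cast
    have : (n : ℂ) ≠ 0 := by exact_mod_cast hn0.ne'
    rw [inv_pow]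
    field_simp
  have hcards := Finset.card_union_add_card_inter (x :: t).toFinset (y :: s).toFinset
  rw [← hrdef] at hcards
  by_cases hdis : ∀ z ∈ x :: t, z ∉ y :: s
  · have hxy : x ≠ y := fun h => hdis x (by simp) (by simp [h])
    have hinter : (x :: t).toFinset ∩ (y :: s).toFinset = ∅ := by
      rw [← Finset.disjoint_iff_inter_eq_empty, Finset.disjoint_left]
      intro z hz hz'
      exact hdis z (List.mem_toFinset.mp hz) (List.mem_toFinset.mp hz')
    rw [hinter, Finset.card_empty, add_zero] at hcards
    have hU : r = ((t ++ s).toFinset \ {x, y}).card + 2 := by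
      rw [hrdef, ← Finset.card_pair hxy, ← Finset.card_union_of_disjoint Finset.sdiff_disjoint]
      congr 1
      ext z
      simp only [Finset.mem_union, List.mem_toFinset, List.mem_cons, Finset.mem_sdiff,
        List.mem_append, Finset.mem_insert, Finset.mem_singleton]
      tauto
    have h1 : pairTerm g p x t y s - ((n⁻¹ ^ (x :: t).toFinset.card * treeInd x t) *
        (n⁻¹ ^ (y :: s).toFinset.card * treeInd y s) : ℝ) =
        ((n⁻¹ ^ r : ℝ) : ℂ) * (pairAvg g p x t y s - (treeInd x t * treeInd y s : ℝ)) := by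
      rw [hpt, ← hsc ((t ++ s).toFinset \ {x, y}), mul_sub]
      congr 1
      · rw [pairAvg, hU]
        push_cast
        ring
      · rw [hcards, ← Complex.ofReal_mul]
        congr 1
        ring
    rw [h1, norm_mul, Complex.norm_real, Real.norm_of_nonneg (by positivity)]
    refine mul_le_mul_of_nonneg_left ?_ (by positivity)
    refine (norm_pairAvg_sub_le hg hμ hr ht hs hdis hK).trans ?_
    have h2 : ((t.length + s.length + 1 : ℕ) : ℝ) ≤ K := by
      exact_mod_cast (by omega : t.length + s.length + 1 ≤ K)
    have h3 : ((t.length + s.length + 1 : ℕ) : ℝ) * ((4 * K + 2) * η * flowBound μ K) ≤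
        K * ((4 * K + 2) * η * flowBound μ K) := by gcongr
    have h4 : 0 ≤ η * (flowBound μ K + 1) := by positivity
    linarith
  · push Not at hdis
    obtain ⟨z, hz, hz'⟩ := hdis
    have hU : r = ((t ++ y :: s).toFinset \ {x}).card + 1 := by
      rw [hrdef, ← Finset.card_singleton x, ← Finset.card_union_of_disjoint Finset.sdiff_disjoint]
      congr 1
      ext z
      simp only [Finset.mem_union, List.mem_toFinset, List.mem_cons, Finset.mem_sdiff,
        List.mem_append, Finset.mem_singleton]
      tauto
    have hflow := ht.rootedFlow_of_inter hs hz hz'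
    have hbd := norm_scaledAvg_le_flowBound hg hμ hr hflow (by
      rw [Finset.union_sdiff_self_eq_union]
      refine (Finset.card_union_le _ _).trans ?_
      have h2 := List.toFinset_card_le (t ++ y :: s)
      rw [List.length_append, List.length_cons] at h2
      rw [Finset.card_singleton]
      omega) (by rw [Multiset.card_add, card_chainEdges, card_chainEdges]; omega)
    have hninv : n⁻¹ ≤ η := by
      refine le_trans ?_ hr.inv_sqrt_le
      rw [one_div]
      refine inv_anti₀ (Real.sqrt_pos.mpr hn0) ?_
      rw [Real.sqrt_le_left hn0.le]
      nlinarith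
    have h1 : ‖pairTerm g p x t y s‖ ≤ n⁻¹ ^ r * (η * flowBound μ K) := by
      have : pairTerm g p x t y s = ((n⁻¹ ^ r * n⁻¹ : ℝ) : ℂ) *
          scaledAvg g p ((t ++ y :: s).toFinset \ {x}) (chainEdges x t + chainEdges y s) := by
        rw [hpt, ← hsc ((t ++ y :: s).toFinset \ {x}), hU]
        push_cast
        ring
      rw [this, norm_mul, Complex.norm_real, Real.norm_of_nonneg (by positivity), mul_assoc]
      gcongr
    have h2 : ‖(((n⁻¹ ^ (x :: t).toFinset.card * treeInd x t) *
        (n⁻¹ ^ (y :: s).toFinset.card * treeInd y s) : ℝ) : ℂ)‖ ≤ n⁻¹ ^ r * η := by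
      obtain ⟨ht0, ht1⟩ := treeInd_mem x t
      obtain ⟨hs0, hs1⟩ := treeInd_mem y s
      rw [Complex.norm_real, Real.norm_of_nonneg (by positivity)]
      have hpos : 1 ≤ ((x :: t).toFinset ∩ (y :: s).toFinset).card :=
        Finset.card_pos.mpr ⟨z, Finset.mem_inter.mpr
          ⟨List.mem_toFinset.mpr hz, List.mem_toFinset.mpr hz'⟩⟩
      calc _ = n⁻¹ ^ ((x :: t).toFinset.card + (y :: s).toFinset.card) *
            (treeInd x t * treeInd y s) := by ring
        _ ≤ n⁻¹ ^ ((x :: t).toFinset.card + (y :: s).toFinset.card) * 1 := by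
            gcongr
            exact mul_le_one₀ ht1 hs0 hs1
        _ ≤ n⁻¹ ^ (r + 1) := by
            rw [mul_one]
            exact pow_le_pow_of_le_one (by positivity) (inv_le_one_of_one_le₀ hn1) (by omega)
        _ ≤ n⁻¹ ^ r * η := by
            rw [pow_succ]
            gcongr
    refine (norm_sub_le _ _).trans ((add_le_add h1 h2).trans ?_)
    rw [← mul_add]
    refine mul_le_mul_of_nonneg_left ?_ (by positivity)
    have h4 : 0 ≤ η * (K * (4 * K + 2) * flowBound μ K) := by positivity
    linarith

/-- The errors of single pairs carry the weight `n ^ (-r)`; this keeps their sum bounded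
independently of `n`. -/
lemma sum_pow_card_union_le [Nonempty I] (k l : ℕ) :
    ∑ x : I, ∑ f : Fin k → I, ∑ y : I, ∑ h : Fin l → I, (Fintype.card I : ℝ)⁻¹ ^
      ((x :: List.ofFn f).toFinset ∪ (y :: List.ofFn h).toFinset).card ≤
      (k + 1 : ℝ) ^ (k + 1) * (k + l + 2 : ℝ) ^ (l + 1) := by
  have h1 : ∀ A : Finset I, A.card ≤ k + 1 → ∑ y : I, ∑ h : Fin l → I, (Fintype.card I : ℝ)⁻¹ ^
      (A ∪ (y :: List.ofFn h).toFinset).card ≤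
      (Fintype.card I : ℝ)⁻¹ ^ A.card * (k + l + 2 : ℝ) ^ (l + 1) := by
    intro A hA
    rw [← sum_ofFn_succ l fun t => (Fintype.card I : ℝ)⁻¹ ^ (A ∪ t.toFinset).card]
    have h2 : ∀ t : List I, (Fintype.card I : ℝ)⁻¹ ^ (A ∪ t.toFinset).card =
        (Fintype.card I : ℝ)⁻¹ ^ A.card * (Fintype.card I : ℝ)⁻¹ ^ (t.toFinset \ A).card := by
      intro t
      rw [← pow_add, ← Finset.union_sdiff_self_eq_union,
        Finset.card_union_of_disjoint Finset.disjoint_sdiff]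
    simp only [h2, ← Finset.mul_sum]
    refine mul_le_mul_of_nonneg_left ((sum_pow_card_sdiff_le (l + 1) A).trans ?_) (by positivity)
    refine pow_le_pow_left₀ (by positivity) ?_ _
    have : (A.card : ℝ) ≤ k + 1 := by exact_mod_cast hA
    push_cast
    linarith
  calc _ ≤ ∑ x : I, ∑ f : Fin k → I, (Fintype.card I : ℝ)⁻¹ ^
        (x :: List.ofFn f).toFinset.card * (k + l + 2 : ℝ) ^ (l + 1) := by
        refine Finset.sum_le_sum fun x _ => Finset.sum_le_sum fun f _ => h1 _ ?_
        have := List.toFinset_card_le (x :: List.ofFn f)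
        rwa [List.length_cons, List.length_ofFn] at this
    _ ≤ _ := by
        simp only [← Finset.sum_mul]
        rw [← sum_ofFn_succ k fun t => (Fintype.card I : ℝ)⁻¹ ^ t.toFinset.card]
        refine mul_le_mul_of_nonneg_right ?_ (by positivity)
        have := sum_pow_card_sdiff_le (I := I) (k + 1) ∅
        simpa using this

/-- The constant in the estimate of the expected product of two moments. -/
noncomputable def momentBound (μ : ℝ) (k l : ℕ) : ℝ :=
  (k + 1 : ℝ) ^ (k + 1) * (k + l + 2 : ℝ) ^ (l + 1) *
    (((k + l + 2 : ℕ) : ℝ) * (4 * ((k + l + 2 : ℕ) : ℝ) + 2) * flowBound μ (k + l + 2) +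
      flowBound μ (k + l + 2) + 1) +
    (k * 2 ^ k * (k + 1) * (l * 2 ^ l * (l + 1) + 2 ^ l) + 2 ^ k * (l * 2 ^ l * (l + 1)))

theorem norm_embAvg_kernelMoment_mul_sub_le (hg : IsCoherentKernel g μ p X) (hμ : 0 ≤ μ)
    (k l : ℕ) (hr : SparseRegime (k + l + 2) (Fintype.card I) p X η) :
    ‖embAvg (fun S : I ↪ D => kernelMoment g p k S * kernelMoment g p l S) -
      ((dyck k 0 * dyck l 0 : ℝ) : ℂ)‖ ≤ momentBound μ k l * η := by
  have hn1 : (1 : ℝ) ≤ (Fintype.card I : ℕ) := hr.one_le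
  have hn0 : (0 : ℝ) < (Fintype.card I : ℕ) := by linarith
  have : Nonempty I := Fintype.card_pos_iff.mp (by exact_mod_cast hn0)
  have hη := hr.eta_nonneg
  have hB := one_le_flowBound μ (k + l + 2)
  set C := ((k + l + 2 : ℕ) : ℝ) * (4 * ((k + l + 2 : ℕ) : ℝ) + 2) * flowBound μ (k + l + 2) +
      flowBound μ (k + l + 2) + 1 with hC
  have hC0 : 0 ≤ C := by positivity
  have h1 : ‖embAvg (fun S : I ↪ D => kernelMoment g p k S * kernelMoment g p l S) -
      ((treeCount I k * treeCount I l : ℝ) : ℂ)‖ ≤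
      (k + 1 : ℝ) ^ (k + 1) * (k + l + 2 : ℝ) ^ (l + 1) * (η * C) := by
    have hG : treeCount I k * treeCount I l = ∑ x : I, ∑ f : Fin k → I, ∑ y : I,
        ∑ h : Fin l → I,
        ((Fintype.card I : ℝ)⁻¹ ^ (x :: List.ofFn f).toFinset.card * treeInd x (List.ofFn f)) *
        ((Fintype.card I : ℝ)⁻¹ ^ (y :: List.ofFn h).toFinset.card *
          treeInd y (List.ofFn h)) := by
      rw [treeCount, treeCount, Finset.sum_mul]
      refine Finset.sum_congr rfl fun x _ => ?_
      rw [Finset.sum_mul]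
      refine Finset.sum_congr rfl fun f _ => ?_
      rw [Finset.mul_sum]
      refine Finset.sum_congr rfl fun y _ => ?_
      rw [Finset.mul_sum]
    rw [embAvg_kernelMoment_mul, hG]
    simp only [Complex.ofReal_sum, ← Finset.sum_sub_distrib]
    refine le_trans ?_ (mul_le_mul_of_nonneg_right (sum_pow_card_union_le (I := I) k l)
      (by positivity))
    simp only [Finset.sum_mul]
    refine (norm_sum_le _ _).trans (Finset.sum_le_sum fun x _ => ?_)
    refine (norm_sum_le _ _).trans (Finset.sum_le_sum fun f _ => ?_)
    refine (norm_sum_le _ _).trans (Finset.sum_le_sum fun y _ => ?_)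
    refine (norm_sum_le _ _).trans (Finset.sum_le_sum fun h _ => ?_)
    exact norm_pairTerm_sub_le hg hμ hr x (List.ofFn f) y (List.ofFn h) (by simp)
  have hninv : (Fintype.card I : ℝ)⁻¹ ≤ η := by
    refine le_trans ?_ hr.inv_sqrt_le
    rw [one_div]
    refine inv_anti₀ (Real.sqrt_pos.mpr hn0) ?_
    rw [Real.sqrt_le_left hn0.le]
    nlinarith
  have hcount : ∀ j : ℕ, |treeCount I j - dyck j 0| ≤ j * 2 ^ j * (j + 1) * η := fun j =>
    (abs_treeCount_sub_le j).trans (by gcongr)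
  have hdy : ∀ j : ℕ, (dyck j 0 : ℝ) ≤ 2 ^ j := fun j => by exact_mod_cast dyck_le j 0
  have h2 : ‖((treeCount I k * treeCount I l : ℝ) : ℂ) - ((dyck k 0 * dyck l 0 : ℝ) : ℂ)‖ ≤
      (k * 2 ^ k * (k + 1) * (l * 2 ^ l * (l + 1) + 2 ^ l) +
        2 ^ k * (l * 2 ^ l * (l + 1))) * η := by
    rw [← Complex.ofReal_sub, Complex.norm_real, Real.norm_eq_abs]
    have e1 : treeCount I k * treeCount I l - dyck k 0 * dyck l 0 =
        (treeCount I k - dyck k 0) * treeCount I l +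
          dyck k 0 * (treeCount I l - dyck l 0) := by ring
    have e2 : |treeCount I l| ≤ l * 2 ^ l * (l + 1) + 2 ^ l := by
      have h3 := hcount l
      have h4 : (l * 2 ^ l * (l + 1) : ℝ) * η ≤ l * 2 ^ l * (l + 1) * 1 := by
        gcongr
        exact hr.le_one
      have h5 := hdy l
      have h6 : (0 : ℝ) ≤ dyck l 0 := by positivity
      rw [abs_le] at h3 ⊢
      constructor <;> linarith
    rw [e1]
    refine (abs_add_le _ _).trans ?_
    rw [abs_mul, abs_mul, abs_of_nonneg (by positivity : (0 : ℝ) ≤ dyck k 0)]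
    calc _ ≤ (k * 2 ^ k * (k + 1) * η) * (l * 2 ^ l * (l + 1) + 2 ^ l) +
          2 ^ k * (l * 2 ^ l * (l + 1) * η) := by
          gcongr
          · exact hcount k
          · exact hdy k
          · exact hcount l
      _ = _ := by ring
  refine (norm_sub_le_norm_sub_add_norm_sub _ _ _).trans ((add_le_add h1 h2).trans_eq ?_)
  rw [momentBound, ← hC]
  ring

end Moments

/-! ### Moments of the semicircle distribution. -/

section Semicircle

lemma integral_cos_natCast_mul {m : ℕ} (hm : m ≠ 0) :
    ∫ θ in (0 : ℝ)..Real.pi, Real.cos (m * θ) = 0 := by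
  have hm' : (m : ℝ) ≠ 0 := by exact_mod_cast hm
  rw [intervalIntegral.integral_comp_mul_left (fun x => Real.cos x) hm', integral_cos]
  simp [Real.sin_nat_mul_pi]

lemma integral_sin_mul_sin (h : ℕ) :
    ∫ θ in (0 : ℝ)..Real.pi, Real.sin ((h + 1) * θ) * Real.sin θ =
      if h = 0 then Real.pi / 2 else 0 := by
  have h1 : ∀ θ : ℝ, Real.sin ((h + 1) * θ) * Real.sin θ =
      2⁻¹ * (Real.cos ((h : ℕ) * θ) - Real.cos (((h + 2 : ℕ) : ℝ) * θ)) := by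
    intro θ
    have e1 : (h : ℝ) * θ = (h + 1) * θ - θ := by ring
    have e2 : ((h + 2 : ℕ) : ℝ) * θ = (h + 1) * θ + θ := by push_cast; ring
    rw [e1, e2, Real.cos_sub, Real.cos_add]
    ring
  simp only [h1]
  rw [intervalIntegral.integral_const_mul, intervalIntegral.integral_sub
    (Continuous.intervalIntegrable (by fun_prop) _ _)
    (Continuous.intervalIntegrable (by fun_prop) _ _),
    integral_cos_natCast_mul (m := h + 2) (by omega)]
  split_ifs with h0
  · subst h0
    simp
    ring
  · rw [integral_cos_natCast_mul h0]
    simp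

/-- The Chebyshev identity `2 cos θ sin((h + 1) θ) = sin((h + 2) θ) + sin(h θ)` is the recursion of
`dyck`. Its last term vanishes for `h = 0`, which is the floor of the lattice path. -/
lemma integral_cos_pow_mul_sin_mul_sin (k h : ℕ) :
    2 / Real.pi * ∫ θ in (0 : ℝ)..Real.pi,
      (2 * Real.cos θ) ^ k * (Real.sin ((h + 1) * θ) * Real.sin θ) = dyck k h := by
  have hpi := Real.pi_pos
  induction k generalizing h with
  | zero =>
    simp only [pow_zero, one_mul, integral_sin_mul_sin]
    cases h with
    | zero => simp [dyck]
    | succ h => simp [dyck]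
  | succ k ih =>
    have h1 : ∀ θ : ℝ, (2 * Real.cos θ) ^ (k + 1) * (Real.sin ((h + 1) * θ) * Real.sin θ) =
        (2 * Real.cos θ) ^ k * (Real.sin (((h + 1 : ℕ) + 1) * θ) * Real.sin θ) +
          (2 * Real.cos θ) ^ k * (Real.sin (h * θ) * Real.sin θ) := by
      intro θ
      have e1 : (h : ℝ) * θ = (h + 1) * θ - θ := by ring
      have e2 : (((h + 1 : ℕ) : ℝ) + 1) * θ = (h + 1) * θ + θ := by push_cast; ring
      rw [e1, e2, Real.sin_sub, Real.sin_add]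
      ring
    simp only [h1]
    rw [intervalIntegral.integral_add (Continuous.intervalIntegrable (by fun_prop) _ _)
      (Continuous.intervalIntegrable (by fun_prop) _ _), mul_add, ih]
    cases h with
    | zero => simp [dyck]
    | succ h =>
      have := ih h
      push_cast at this ⊢
      rw [this, dyck]
      push_cast
      rfl

lemma integral_semicircleDistribution (f : ℝ → ℝ) :
    ∫ x, f x ∂semicircleDistribution =
      ∫ x in Set.Icc (-2 : ℝ) 2, 1 / (2 * Real.pi) * √(4 - x ^ 2) * f x := by
  have hpi := Real.pi_pos
  have hnn : ∀ x : ℝ, 0 ≤ (Set.Icc (-2 : ℝ) 2).indicator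
      (fun y : ℝ => 1 / (2 * Real.pi) * √(4 - y ^ 2)) x :=
    fun x => Set.indicator_nonneg (fun y _ => by positivity) x
  unfold semicircleDistribution
  rw [integral_withDensity_eq_integral_toReal_smul]
  · rw [← integral_indicator measurableSet_Icc]
    refine integral_congr_ae (ae_of_all _ fun x => ?_)
    simp only [ENNReal.toReal_ofReal (hnn x), smul_eq_mul]
    by_cases hx : x ∈ Set.Icc (-2 : ℝ) 2 <;> simp [hx]
  · exact ((Continuous.measurable (by fun_prop)).indicator measurableSet_Icc).ennreal_ofReal
  · exact ae_of_all _ fun x => ENNReal.ofReal_lt_top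

lemma integrable_semicircleDistribution {f : ℝ → ℝ} (hf : Continuous f) :
    Integrable f semicircleDistribution := by
  have hpi := Real.pi_pos
  have hnn : ∀ x : ℝ, 0 ≤ (Set.Icc (-2 : ℝ) 2).indicator
      (fun y : ℝ => 1 / (2 * Real.pi) * √(4 - y ^ 2)) x :=
    fun x => Set.indicator_nonneg (fun y _ => by positivity) x
  unfold semicircleDistribution
  rw [integrable_withDensity_iff_integrable_smul']
  · have h : IntegrableOn (fun x => 1 / (2 * Real.pi) * √(4 - x ^ 2) * f x)
        (Set.Icc (-2 : ℝ) 2) := Continuous.integrableOn_Icc (by fun_prop)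
    rw [← integrable_indicator_iff measurableSet_Icc] at h
    refine h.congr (ae_of_all _ fun x => ?_)
    simp only [ENNReal.toReal_ofReal (hnn x), smul_eq_mul]
    by_cases hx : x ∈ Set.Icc (-2 : ℝ) 2 <;> simp [hx]
  · exact ((Continuous.measurable (by fun_prop)).indicator measurableSet_Icc).ennreal_ofReal
  · exact ae_of_all _ fun x => ENNReal.ofReal_lt_top

/-- The moments of the semicircle distribution. -/
theorem integral_pow_semicircleDistribution (k : ℕ) :
    ∫ x, x ^ k ∂semicircleDistribution = dyck k 0 := by
  have hpi := Real.pi_pos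
  rw [integral_semicircleDistribution, integral_Icc_eq_integral_Ioc,
    ← intervalIntegral.integral_of_le (by norm_num), ← integral_cos_pow_mul_sin_mul_sin]
  -- The substitution `x = 2 cos θ` reverses the orientation, hence `integral_symm` below.
  have h := intervalIntegral.integral_comp_mul_deriv (a := 0) (b := Real.pi)
    (f := fun θ => 2 * Real.cos θ) (f' := fun θ => 2 * -Real.sin θ)
    (g := fun x => 1 / (2 * Real.pi) * √(4 - x ^ 2) * x ^ k)
    (fun θ _ => (Real.hasDerivAt_cos θ).const_mul 2) (by fun_prop) (by fun_prop)
  rw [Real.cos_zero, Real.cos_pi, mul_one, mul_neg, mul_one] at h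
  rw [intervalIntegral.integral_symm, ← h, ← intervalIntegral.integral_neg, ← intervalIntegral.integral_const_mul]
  refine intervalIntegral.integral_congr fun θ hθ => ?_
  rw [Set.uIcc_of_le hpi.le] at hθ
  have hs : 0 ≤ Real.sin θ := Real.sin_nonneg_of_nonneg_of_le_pi hθ.1 hθ.2
  have h2 : √(4 - (2 * Real.cos θ) ^ 2) = 2 * Real.sin θ := by
    rw [← Real.sqrt_sq (by positivity : 0 ≤ 2 * Real.sin θ)]
    congr 1
    linear_combination -4 * Real.sin_sq_add_cos_sq θ
  simp only [Function.comp, h2, Nat.cast_zero, zero_add, one_mul]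
  field_simp

instance : IsProbabilityMeasure semicircleDistribution := by
  constructor
  have h := integral_pow_semicircleDistribution 0
  simp only [pow_zero, integral_const, smul_eq_mul, mul_one, dyck, Nat.cast_one] at h
  rw [Measure.real, ENNReal.toReal_eq_one_iff] at h
  exact h

end Semicircle

/-! ### From moments to bounded continuous test functions. -/

section MomentMethod

/-- Closeness of finitely many moments to those of the semicircle distribution bounds the
difference of the integrals of a bounded continuous function. -/
theorem exists_moment_bound (f : ℝ →ᵇ ℝ) {δ : ℝ} (hδ : 0 < δ) :
    ∃ M : ℕ, ∃ δ' > 0, ∀ ρ : Measure ℝ, IsProbabilityMeasure ρ →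
      (∀ k : ℕ, Integrable (fun x : ℝ => x ^ k) ρ) →
      (∀ k ≤ M, |∫ x, x ^ k ∂ρ - dyck k 0| < δ') →
      |∫ x, f x ∂ρ - ∫ x, f x ∂semicircleDistribution| < δ := by
  -- In total `5 γ` is spent: `2 γ` for the polynomial approximation under each measure, and `γ` for
  -- comparing the integrals of the polynomial.
  set γ := δ / 8 with hγ
  have hγ0 : 0 < γ := by positivity
  -- No bound on the support of `ρ` is available. An interval strictly larger than `[-2, 2]` is
  -- chosen so that `x ^ 2 ≥ 9` outside it beats the growth `4 ^ m` of the even moments; this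
  -- produces the ratio `4 / 9`.
  obtain ⟨q, hq⟩ := exists_polynomial_near_of_continuousOn (-3) 3 f f.continuous.continuousOn γ hγ0
  set d := q.natDegree with hd
  set Q : ℝ := ∑ i ∈ Finset.range (d + 1), |q.coeff i| with hQ
  have hQ0 : 0 ≤ Q := Finset.sum_nonneg fun i _ => abs_nonneg _
  have hev : ∀ x, q.eval x = ∑ i ∈ Finset.range (d + 1), q.coeff i * x ^ i :=
    fun x => Polynomial.eval_eq_sum_range x
  set A : ℝ := ‖f‖ + Q with hA
  have hA0 : 0 ≤ A := by positivity
  obtain ⟨j, hj⟩ : ∃ j : ℕ, A * (2 * 4 ^ d) * (4 / 9 : ℝ) ^ j < γ := by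
    have : Tendsto (fun j : ℕ => A * (2 * 4 ^ d) * (4 / 9 : ℝ) ^ j) atTop (𝓝 (A * (2 * 4 ^ d) * 0)) :=
      (tendsto_pow_atTop_nhds_zero_of_lt_one (by norm_num) (by norm_num)).const_mul _
    rw [mul_zero] at this
    exact (this.eventually (gt_mem_nhds hγ0)).exists
  -- Outside `[-3, 3]` the difference is at most `A x ^ (2 d)`, and the inserted factor `(x ^ 2 / 9)
  -- ^ j ≥ 1` provides the small constant `9 ^ (-j)`.
  have hpt : ∀ x : ℝ, |f x - q.eval x| ≤ γ + A / 9 ^ j * x ^ (2 * (d + j)) := by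
    intro x
    by_cases hx : |x| ≤ 3
    · have h1 := hq x (abs_le.mp hx)
      rw [abs_sub_comm] at h1
      have : 0 ≤ A / 9 ^ j * x ^ (2 * (d + j)) := by
        rw [pow_mul]; positivity
      linarith
    · push Not at hx
      have hx1 : 1 ≤ |x| := by linarith
      have h9 : 9 ≤ x ^ 2 := by rw [← sq_abs]; nlinarith
      have h1 : |f x| ≤ ‖f‖ := f.norm_coe_le_norm x
      have h2 : |q.eval x| ≤ Q * (x ^ 2) ^ d := by
        rw [hev, hQ, Finset.sum_mul]
        refine (Finset.abs_sum_le_sum_abs _ _).trans (Finset.sum_le_sum fun i hi => ?_)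
        rw [abs_mul, abs_pow, ← sq_abs, ← pow_mul]
        refine mul_le_mul_of_nonneg_left (pow_le_pow_right₀ hx1 ?_) (abs_nonneg _)
        have := Finset.mem_range.mp hi
        omega
      have h3 : 1 ≤ (x ^ 2) ^ d := one_le_pow₀ (by linarith)
      have h4 : |f x - q.eval x| ≤ A * (x ^ 2) ^ d := by
        refine (abs_sub _ _).trans ?_
        have : ‖f‖ ≤ ‖f‖ * (x ^ 2) ^ d := le_mul_of_one_le_right (norm_nonneg _) h3
        rw [hA, add_mul]
        linarith
      have h5 : (9 : ℝ) ^ j ≤ (x ^ 2) ^ j := pow_le_pow_left₀ (by norm_num) h9 _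
      have h6 : A * (x ^ 2) ^ d ≤ A / 9 ^ j * x ^ (2 * (d + j)) := by
        rw [pow_mul, pow_add, div_mul_eq_mul_div, le_div_iff₀ (by positivity)]
        have : 0 ≤ A * (x ^ 2) ^ d := by positivity
        nlinarith
      linarith
  refine ⟨2 * (d + j), min 1 (γ / (1 + Q)), by positivity, fun ρ hρ hint hmom => ?_⟩
  have hintq : ∀ ρ : Measure ℝ, (∀ k : ℕ, Integrable (fun x : ℝ => x ^ k) ρ) →
      Integrable (fun x => q.eval x) ρ := by
    intro ρ hint
    simp only [hev]
    exact integrable_finsetSum _ fun i _ => (hint i).const_mul _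
  have happrox : ∀ ρ : Measure ℝ, IsProbabilityMeasure ρ →
      (∀ k : ℕ, Integrable (fun x : ℝ => x ^ k) ρ) →
      |∫ x, x ^ (2 * (d + j)) ∂ρ - dyck (2 * (d + j)) 0| < 1 →
      |∫ x, f x ∂ρ - ∫ x, q.eval x ∂ρ| ≤ 2 * γ := by
    intro ρ hρ hint hm
    rw [← integral_sub (f.integrable ρ) (hintq ρ hint)]
    refine (abs_integral_le_integral_abs).trans ?_
    calc ∫ x, |f x - q.eval x| ∂ρ ≤ ∫ x, (γ + A / 9 ^ j * x ^ (2 * (d + j))) ∂ρ :=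
          integral_mono ((f.integrable ρ).sub (hintq ρ hint)).abs
            ((integrable_const _).add ((hint _).const_mul _)) hpt
      _ = γ + A / 9 ^ j * ∫ x, x ^ (2 * (d + j)) ∂ρ := by
          rw [integral_add (integrable_const _) ((hint _).const_mul _), integral_const_mul]
          simp
      _ ≤ γ + A / 9 ^ j * (2 * 4 ^ (d + j)) := by
          gcongr
          have h1 : (dyck (2 * (d + j)) 0 : ℝ) ≤ 4 ^ (d + j) := by
            have := dyck_le (2 * (d + j)) 0
            rw [pow_mul] at this
            exact_mod_cast this
          have h2 : (1 : ℝ) ≤ 4 ^ (d + j) := one_le_pow₀ (by norm_num)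
          linarith [(abs_lt.mp hm).2]
      _ = γ + A * (2 * 4 ^ d) * (4 / 9 : ℝ) ^ j := by
          rw [div_pow, pow_add]
          field_simp
      _ ≤ 2 * γ := by linarith
  have hintsc : ∀ k : ℕ, Integrable (fun x : ℝ => x ^ k) semicircleDistribution :=
    fun k => integrable_semicircleDistribution (by fun_prop)
  have h1 := happrox ρ hρ hint ((hmom _ le_rfl).trans_le (min_le_left _ _))
  have h2 := happrox semicircleDistribution inferInstance hintsc
    (by simp [integral_pow_semicircleDistribution])
  have hsum : ∀ ρ : Measure ℝ, (∀ k : ℕ, Integrable (fun x : ℝ => x ^ k) ρ) →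
      ∫ x, q.eval x ∂ρ = ∑ i ∈ Finset.range (d + 1), q.coeff i * ∫ x, x ^ i ∂ρ := by
    intro ρ hint
    simp only [hev]
    rw [integral_finsetSum _ fun i _ => (hint i).const_mul _]
    simp only [integral_const_mul]
  have h3 : |∫ x, q.eval x ∂ρ - ∫ x, q.eval x ∂semicircleDistribution| ≤ γ := by
    rw [hsum ρ hint, hsum _ hintsc, ← Finset.sum_sub_distrib]
    refine (Finset.abs_sum_le_sum_abs _ _).trans ?_
    calc _ ≤ ∑ i ∈ Finset.range (d + 1), |q.coeff i| * (γ / (1 + Q)) := by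
          refine Finset.sum_le_sum fun i hi => ?_
          rw [← mul_sub, abs_mul, integral_pow_semicircleDistribution]
          refine mul_le_mul_of_nonneg_left ?_ (abs_nonneg _)
          have := Finset.mem_range.mp hi
          exact (hmom i (by omega)).le.trans (min_le_right _ _)
      _ = Q * (γ / (1 + Q)) := by rw [← Finset.sum_mul]
      _ ≤ γ := by
          rw [← mul_div_assoc, div_le_iff₀ (by positivity)]
          nlinarith
  rw [abs_le] at h1 h2 h3
  rw [abs_lt]
  constructor <;> linarith

end MomentMethod

/-! ### Traces of powers and Chebyshev's inequality. -/

lemma Matrix.IsHermitian.trace_pow_eq_sum_eigenvalues {ι : Type*} [Fintype ι] [DecidableEq ι]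
    {A : Matrix ι ι ℂ} (hA : A.IsHermitian) (k : ℕ) :
    (A ^ k).trace = ∑ i, ((hA.eigenvalues i : ℝ) : ℂ) ^ k := by
  conv_lhs => rw [hA.spectral_theorem]
  rw [← map_pow, Unitary.conjStarAlgAut_apply, Matrix.trace_mul_cycle, Unitary.coe_star_mul_self,
    one_mul, Matrix.diagonal_pow, Matrix.trace_diagonal]
  rfl

/-- Chebyshev's inequality by counting; an empty sample space is allowed. -/
lemma uniformOn_univ_le_of_sq {Ω : Type*} [MeasurableSpace Ω] [DiscreteMeasurableSpace Ω]
    [Fintype Ω] (Y : Ω → ℝ) {δ : ℝ} (hδ : 0 < δ) :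
    ProbabilityTheory.uniformOn Set.univ {ω | δ ≤ |Y ω|} ≤
      ENNReal.ofReal ((Fintype.card Ω : ℝ)⁻¹ * (∑ ω, Y ω ^ 2) / δ ^ 2) := by
  classical
  have hset : {ω | δ ≤ |Y ω|} = ((Finset.univ.filter fun ω => δ ≤ |Y ω| : Finset Ω) : Set Ω) := by
    ext
    simp
  set T := Finset.univ.filter fun ω => δ ≤ |Y ω| with hT
  rw [hset, ProbabilityTheory.uniformOn_univ, Measure.count_apply_finset]
  rcases isEmpty_or_nonempty Ω with hΩ | hΩ
  · have : T = ∅ := Finset.eq_empty_of_isEmpty T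
    simp [this]
  have hN : (0 : ℝ) < Fintype.card Ω := by exact_mod_cast Fintype.card_pos
  have h1 : (T.card : ℝ) * δ ^ 2 ≤ ∑ ω, Y ω ^ 2 := by
    rw [← nsmul_eq_mul]
    calc _ ≤ ∑ ω ∈ T, Y ω ^ 2 := by
          refine Finset.card_nsmul_le_sum _ _ _ fun ω hω => ?_
          rw [← sq_abs (Y ω)]
          exact pow_le_pow_left₀ hδ.le (Finset.mem_filter.mp hω).2 _
      _ ≤ _ := Finset.sum_le_sum_of_subset_of_nonneg (Finset.subset_univ _)
          fun _ _ _ => sq_nonneg _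
  calc (T.card : ENNReal) / (Fintype.card Ω : ENNReal) =
        ENNReal.ofReal ((T.card : ℝ) / Fintype.card Ω) := by
        rw [ENNReal.ofReal_div_of_pos hN, ENNReal.ofReal_natCast, ENNReal.ofReal_natCast]
    _ ≤ _ := by
        refine ENNReal.ofReal_le_ofReal ?_
        rw [div_le_div_iff₀ hN (by positivity)]
        have : (Fintype.card Ω : ℝ)⁻¹ * (∑ ω, Y ω ^ 2) * Fintype.card Ω = ∑ ω, Y ω ^ 2 := by
          field_simp
        rw [this]
        exact h1

/-! ### The Gram kernel of a dictionary and concentration of its moments. -/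

section Dictionary

variable {X : Type v} {p n : ℕ} {H : Type u} [NormedAddCommGroup H] [InnerProductSpace ℂ H]

/-- The Gram kernel of the atoms of a dictionary. -/
noncomputable def gramKernel (B : X → OrthonormalBasis (Fin p) ℂ H) (a b : Atom X p) : ℂ :=
  inner ℂ (B a.1 a.2) (B b.1 b.2)

/-- Parseval in each basis contributes one copy of the kernel to the reproducing identity. Distinct
atoms of one basis are orthogonal, so coherence matters only across bases. -/
lemma isCoherentKernel_gramKernel [Fintype X] (B : X → OrthonormalBasis (Fin p) ℂ H) {μ : ℝ}
    (hμ : 0 ≤ μ) (hB : PairwiseCoherent μ B) :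
    IsCoherentKernel (gramKernel B) μ p (Fintype.card X) where
  diag a := by
    rw [gramKernel, inner_self_eq_norm_sq_to_K, (B a.1).norm_eq_one]
    simp
  coherent := by
    rintro ⟨x, i⟩ ⟨y, j⟩ hab
    by_cases hxy : x = y
    · subst hxy
      have hij : i ≠ j := fun h => hab (by rw [h])
      rw [gramKernel, (B x).inner_eq_zero hij, norm_zero]
      positivity
    · exact hB x y hxy i j
  reproducing a c := by
    rw [Fintype.sum_prod_type]
    simp only [gramKernel, OrthonormalBasis.sum_inner_mul_inner, Finset.sum_const,
      Finset.card_univ, nsmul_eq_mul]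
    norm_cast
  card := by simp

lemma errorTerm_eq_kernelMatrix (B : X → OrthonormalBasis (Fin p) ℂ H) (S : Sample X p n) :
    errorTerm B S = kernelMatrix (gramKernel B) p (S : Fin n ↪ Atom X p) := by
  ext i j
  change (√((p : ℝ) / n) • (sampleGram B S - 1)) i j =
    if i = j then 0 else ((√((p : ℝ) / Fintype.card (Fin n)) : ℝ) : ℂ) * _
  rw [Matrix.smul_apply, Matrix.sub_apply, sampleGram, Matrix.gram_apply, Fintype.card_fin]
  by_cases hij : i = j
  · subst hij
    rw [if_pos rfl, inner_self_eq_norm_sq_to_K, (B _).norm_eq_one]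
    simp
  · rw [if_neg hij, Matrix.one_apply_ne hij, sub_zero, Complex.real_smul]
    rfl

lemma integrable_errorSpectralDistribution (B : X → OrthonormalBasis (Fin p) ℂ H)
    (S : Sample X p n) (hn : n ≠ 0) (f : ℝ → ℝ) :
    Integrable f (errorSpectralDistribution B S) := by
  refine Integrable.smul_measure ?_ (by simpa using hn)
  rw [integrable_finsetSum_measure]
  exact fun i _ => integrable_dirac (by simp)

lemma isProbabilityMeasure_errorSpectralDistribution (B : X → OrthonormalBasis (Fin p) ℂ H)
    (S : Sample X p n) (hn : n ≠ 0) : IsProbabilityMeasure (errorSpectralDistribution B S) := by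
  constructor
  rw [errorSpectralDistribution, Measure.smul_apply, Measure.finsetSum_apply]
  simp only [measure_univ, Finset.sum_const, Finset.card_univ, Fintype.card_fin, nsmul_eq_mul,
    mul_one, smul_eq_mul]
  exact ENNReal.inv_mul_cancel (by exact_mod_cast hn) (ENNReal.natCast_ne_top n)

lemma integral_pow_errorSpectralDistribution (B : X → OrthonormalBasis (Fin p) ℂ H)
    (S : Sample X p n) (k : ℕ) :
    ((∫ x, x ^ k ∂(errorSpectralDistribution B S) : ℝ) : ℂ) =
      kernelMoment (gramKernel B) p k (S : Fin n ↪ Atom X p) := by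
  change _ = (Fintype.card (Fin n) : ℂ)⁻¹ * (kernelMatrix _ _ _ ^ k).trace
  rw [errorSpectralDistribution, integral_smul_measure,
    integral_finsetSum_measure fun i _ => integrable_dirac (by simp),
    ← errorTerm_eq_kernelMatrix, (errorTerm_isHermitian B S).trace_pow_eq_sum_eigenvalues]
  simp

/-- A single moment is thereby a product with the zeroth one, and the estimate for products yields
means as well as second moments. -/
lemma kernelMoment_zero (B : X → OrthonormalBasis (Fin p) ℂ H) (hn : n ≠ 0)
    (S : Fin n ↪ Atom X p) : kernelMoment (gramKernel B) p 0 S = 1 := by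
  simp [kernelMoment, hn]

/-- The constant in the tail bound for the `k`-th moment. -/
noncomputable def varianceBound (μ : ℝ) (k : ℕ) : ℝ :=
  momentBound μ k k + 2 * 2 ^ k * momentBound μ k 0

open Classical in
noncomputable instance [Fintype X] : Fintype (Sample X p n) :=
  inferInstanceAs (Fintype (Fin n ↪ Atom X p))

lemma uniformSample_moment_le [Fintype X] (B : X → OrthonormalBasis (Fin p) ℂ H) {μ η : ℝ}
    (hμ : 0 ≤ μ) (hB : PairwiseCoherent μ B) (k : ℕ)
    (hr : SparseRegime (2 * k + 2) n p (Fintype.card X) η) {δ : ℝ} (hδ : 0 < δ) :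
    uniformSample X p n
        {S | δ ≤ |∫ x, x ^ k ∂(errorSpectralDistribution B S) - dyck k 0|} ≤
      ENNReal.ofReal (varianceBound μ k * η / δ ^ 2) := by
  classical
  have hn : n ≠ 0 := by
    rintro rfl
    have := hr.one_le
    norm_num at this
  have hη := hr.eta_nonneg
  have hg := isCoherentKernel_gramKernel B hμ hB
  have hr1 : SparseRegime (k + k + 2) (Fintype.card (Fin n) : ℕ) p (Fintype.card X) η := by
    rw [Fintype.card_fin]
    convert hr using 2
    ring
  have hr2 : SparseRegime (k + 0 + 2) (Fintype.card (Fin n) : ℕ) p (Fintype.card X) η := by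
    rw [Fintype.card_fin]
    refine { hr with two_mul_le := le_trans ?_ hr.two_mul_le }
    push_cast
    linarith [(Nat.cast_nonneg k : (0 : ℝ) ≤ k)]
  have h1 := norm_embAvg_kernelMoment_mul_sub_le (I := Fin n) hg hμ k k hr1
  have h2 := norm_embAvg_kernelMoment_mul_sub_le (I := Fin n) hg hμ k 0 hr2
  have : DiscreteMeasurableSpace (Sample X p n) := ⟨fun _ => trivial⟩
  refine (uniformOn_univ_le_of_sq _ hδ).trans (ENNReal.ofReal_le_ofReal ?_)
  refine div_le_div_of_nonneg_right ?_ (by positivity)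
  set m : (Fin n ↪ Atom X p) → ℝ :=
    fun S => ∫ x, x ^ k ∂(errorSpectralDistribution B (S : Sample X p n)) with hm
  set D : ℝ := ((dyck k 0 : ℕ) : ℝ) with hD
  have hD2 : D ≤ 2 ^ k := by rw [hD]; exact_mod_cast dyck_le k 0
  have hD0 : 0 ≤ D := by positivity
  have hmk : ∀ S, (m S : ℂ) = kernelMoment (gramKernel B) p k S :=
    fun S => integral_pow_errorSpectralDistribution B S k
  simp only [kernelMoment_zero B hn, ← hmk] at h1 h2
  have hne : (Fintype.card (Fin n ↪ Atom X p) : ℂ)⁻¹ * (Fintype.card (Fin n ↪ Atom X p) : ℂ) = 1 := by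
    have := embAvg_one (hr2.card_le hg)
    simpa [embAvg] using this
  -- With `E` the average, `E (m - D)^2 = (E m^2 - D^2) - 2 D (E m - D)`, and both brackets are
  -- instances of the product estimate, the second with `l = 0`.
  have key : (((Fintype.card (Fin n ↪ Atom X p) : ℝ)⁻¹ * ∑ S, (m S - D) ^ 2 : ℝ) : ℂ) =
      (embAvg (fun S => (m S : ℂ) * m S) - ((D * D : ℝ) : ℂ)) -
        (2 * D : ℝ) * (embAvg (fun S => (m S : ℂ) * 1) - ((D * (dyck 0 0 : ℕ) : ℝ) : ℂ)) := by
    have h3 : ∀ S, (m S - D) ^ 2 = m S * m S - 2 * D * m S + D * D := fun S => by ring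
    simp only [h3, Finset.sum_add_distrib, Finset.sum_sub_distrib, ← Finset.mul_sum,
      Finset.sum_const, Finset.card_univ, nsmul_eq_mul, embAvg, dyck]
    push_cast
    simp only [mul_one]
    linear_combination (D : ℂ) * D * hne
  have h4 := norm_sub_le (embAvg (fun S => (m S : ℂ) * m S) - ((D * D : ℝ) : ℂ))
    ((2 * D : ℝ) * (embAvg (fun S => (m S : ℂ) * 1) - ((D * (dyck 0 0 : ℕ) : ℝ) : ℂ)))
  rw [← key, Complex.norm_real, norm_mul ((2 * D : ℝ) : ℂ), Complex.norm_real (2 * D),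
    Real.norm_of_nonneg (by positivity : 0 ≤ 2 * D)] at h4
  refine (Real.le_norm_self _).trans (h4.trans ?_)
  have h5 : 2 * D * ‖embAvg (fun S => (m S : ℂ) * 1) - ((D * (dyck 0 0 : ℕ) : ℝ) : ℂ)‖ ≤
      2 * 2 ^ k * (momentBound μ k 0 * η) := by gcongr
  rw [varianceBound, add_mul]
  linarith

end Dictionary

/-! ### Passage to the limit. -/

section Limit

lemma tendsto_subtype_coe_atTop {P : Set ℕ} (hP : P.Infinite) :
    Tendsto (fun p : P => (p : ℕ)) atTop atTop := by
  have := hP.nonempty.to_subtype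
  refine tendsto_atTop_atTop.mpr fun b => ?_
  obtain ⟨a, ha, hab⟩ := hP.exists_gt b
  exact ⟨⟨a, ha⟩, fun c hc => hab.le.trans hc⟩

end Limit

theorem theorem7 (P : Set ℕ) (hP : P.Infinite)
    (H : P → Type u) [∀ p, NormedAddCommGroup (H p)] [∀ p, InnerProductSpace ℂ (H p)]
    (X : P → Type v) [∀ p, Fintype (X p)]
    (hX : Tendsto (fun p : P => Fintype.card (X p)) atTop atTop)
    (B : ∀ p : P, X p → OrthonormalBasis (Fin (p : ℕ)) ℂ (H p))
    (μ : ℝ) (hμ : 0 < μ) (hB : ∀ p : P, PairwiseCoherent μ (B p))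
    (ε : ℝ) (hε0 : 0 < ε) (hε1 : ε < 1)
    (n : P → ℕ)
    (hn : (fun p : P => (n p : ℝ)) ~[atTop] (fun p : P => ((p : ℕ) : ℝ) ^ (1 - ε))) :
    TendstoInProbabilityWeakly
      (fun p : P => uniformSample (X p) (p : ℕ) (n p))
      (fun (p : P) (S : Sample (X p) (p : ℕ) (n p)) => errorSpectralDistribution (B p) S)
      atTop semicircleDistribution := by
  have hp : Tendsto (fun p : P => ((p : ℕ) : ℝ)) atTop atTop :=
    tendsto_natCast_atTop_atTop.comp (tendsto_subtype_coe_atTop hP)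
  have hX' : Tendsto (fun p : P => (Fintype.card (X p) : ℝ)) atTop atTop :=
    tendsto_natCast_atTop_atTop.comp hX
  have hpow : Tendsto (fun p : P => ((p : ℕ) : ℝ) ^ (1 - ε)) atTop atTop :=
    (tendsto_rpow_atTop (by linarith)).comp hp
  have hn' : Tendsto (fun p : P => (n p : ℝ)) atTop atTop := hn.symm.tendsto_atTop hpow
  have hratio : Tendsto (fun p : P => (n p : ℝ) / (p : ℕ)) atTop (𝓝 0) := by
    have h1 : (fun p : P => (n p : ℝ) / (p : ℕ)) ~[atTop]
        (fun p : P => ((p : ℕ) : ℝ) ^ (1 - ε) / (p : ℕ)) := hn.div .refl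
    refine h1.symm.tendsto_nhds ?_
    have h2 : Tendsto (fun p : P => ((p : ℕ) : ℝ) ^ (-ε)) atTop (𝓝 0) :=
      (tendsto_rpow_neg_atTop hε0).comp hp
    refine h2.congr' ?_
    filter_upwards [hp.eventually_gt_atTop 0] with p hp0
    rw [← Real.rpow_sub_one hp0.ne']
    congr 1
    ring
  -- The summands are the costs of a shortcut, of a graph without removable vertices, and of a
  -- collision.
  set η : P → ℝ := fun p =>
    √((n p : ℝ) / (p : ℕ)) + 1 / √(n p : ℝ) + 1 / (Fintype.card (X p) : ℝ) with hη
  have hη0 : Tendsto η atTop (𝓝 0) := by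
    have h1 : Tendsto (fun p : P => √((n p : ℝ) / (p : ℕ))) atTop (𝓝 0) := by
      simpa using hratio.sqrt
    have h2 : Tendsto (fun p : P => 1 / √(n p : ℝ)) atTop (𝓝 0) :=
      tendsto_const_nhds.div_atTop (Real.tendsto_sqrt_atTop.comp hn')
    have h3 : Tendsto (fun p : P => 1 / (Fintype.card (X p) : ℝ)) atTop (𝓝 0) :=
      tendsto_const_nhds.div_atTop hX'
    simpa only [add_zero] using (h1.add h2).add h3
  have hregime : ∀ K : ℕ, ∀ᶠ p : P in atTop,
      SparseRegime K (n p) (p : ℕ) (Fintype.card (X p)) (η p) := by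
    intro K
    filter_upwards [hn'.eventually_ge_atTop 1, hp.eventually_gt_atTop 0,
      hratio.eventually_le_const one_pos, hX'.eventually_gt_atTop 0,
      hX'.eventually_ge_atTop (2 * K), hη0.eventually_le_const one_pos] with p h1 h2 h3 h4 h5 h6
    have e1 : 0 ≤ √((n p : ℝ) / (p : ℕ)) := Real.sqrt_nonneg _
    have e2 : 0 ≤ 1 / √(n p : ℝ) := by positivity
    have e3 : 0 ≤ 1 / (Fintype.card (X p) : ℝ) := by positivity
    exact
      { one_le := h1
        le_dim := by rwa [div_le_one h2] at h3
        pos := h4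
        two_mul_le := h5
        le_one := h6
        sqrt_le := by simp only [hη]; linarith
        inv_sqrt_le := by simp only [hη]; linarith
        inv_le := by simp only [hη]; linarith }
  intro f δ hδ
  obtain ⟨M, δ', hδ', hM⟩ := exists_moment_bound f hδ
  have hlim : Tendsto (fun p : P => ∑ k ∈ Finset.range (M + 1),
      ENNReal.ofReal (varianceBound μ k * η p / δ' ^ 2)) atTop (𝓝 0) := by
    have h1 : ∀ k ∈ Finset.range (M + 1), Tendsto (fun p : P =>
        ENNReal.ofReal (varianceBound μ k * η p / δ' ^ 2)) atTop (𝓝 0) := by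
      intro k _
      have := ENNReal.tendsto_ofReal ((hη0.const_mul (varianceBound μ k)).div_const (δ' ^ 2))
      simpa using this
    simpa using tendsto_finsetSum _ h1
  refine tendsto_of_tendsto_of_tendsto_of_le_of_le' tendsto_const_nhds hlim
    (Eventually.of_forall fun _ => zero_le) ?_
  have hall : ∀ᶠ p : P in atTop, ∀ k ∈ Finset.range (M + 1),
      SparseRegime (2 * k + 2) (n p) (p : ℕ) (Fintype.card (X p)) (η p) :=
    (Filter.eventually_all_finset _).mpr fun k _ => hregime _
  filter_upwards [hall, hregime 0] with p hp1 hp0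
  have hn0 : n p ≠ 0 := by
    intro h
    have := hp0.one_le
    rw [h] at this
    norm_num at this
  calc uniformSample (X p) p (n p) {S | δ ≤ |∫ x, f x ∂(errorSpectralDistribution (B p) S) -
        ∫ x, f x ∂semicircleDistribution|}
      ≤ uniformSample (X p) p (n p) (⋃ k ∈ Finset.range (M + 1),
        {S | δ' ≤ |∫ x, x ^ k ∂(errorSpectralDistribution (B p) S) - dyck k 0|}) := by
        refine measure_mono fun S hS => ?_
        by_contra hcon
        simp only [Set.mem_iUnion, Finset.mem_range, Set.mem_ofPred_eq, exists_prop, not_exists,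
          not_and, not_le] at hcon
        have := hM _ (isProbabilityMeasure_errorSpectralDistribution (B p) S hn0)
          (fun k => integrable_errorSpectralDistribution (B p) S hn0 _)
          (fun k hk => hcon k (by omega))
        exact absurd hS (not_le.mpr this)
    _ ≤ ∑ k ∈ Finset.range (M + 1), uniformSample (X p) p (n p)
        {S | δ' ≤ |∫ x, x ^ k ∂(errorSpectralDistribution (B p) S) - dyck k 0|} :=
        measure_biUnion_finset_le _ _
    _ ≤ _ := Finset.sum_le_sum fun k hk =>
        uniformSample_moment_le (B p) hμ.le (hB p) k (hp1 k hk) hδ'
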